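/- **Setting.** Let $f:[0,1]^d\times\mathbb R^p\to\mathbb R$, with $d,p\ge 1$, be a loss such that * for every $x\in[0,1]^d$, $f(x;\cdot)$ is differentiable, its gradient $\nabla_\theta f(x;\cdot)$ is $L_1$-Lipschitz, and $f(x;\cdot)$ is $\mu$-strongly convex; * for every $\vartheta\in\mathbb R^p$ and $i\in[p]$, the function $\frac{\partial f}{\partial\theta_i}(\cdot;\vartheta)$ is in the $(\eta,L_2)$-Hölder class on $[0,1]^d$: it is $l=\lceil\eta\rceil-1$ times continuously differentiable and $|\nabla^s g(y_1)-\nabla^s g(y_2)|\le L_2\|y_1-y_2\|_1^{\eta-l}$ for all multi-indices $|s|=l$. Here $0<\mu<L_1$, $L_2>0$, $\eta>0$. Put $\sigma=L_1/\mu$, $q=1/\sigma$, $\kappa=L_1-\mu$. For data $x^{(1)},\dots,x^{(n)}\in[\rho,1-\rho]^d$ with a fixed margin $\rho>0$, let $F(\theta)=\frac1n\sum_j f(x^{(j)};\theta)$ and $F^\star=\inf F$. **LPI-GD.** Let $K$ be a nonnegative bounded kernel on $\mathbb R$ that vanishes outside $[-1,1]$ and is bounded away from $0$ near $0$. The grid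 is $\mathcal G_m=\{u\in[0,1]^d: mu_i\in\{1,\dots,m\}\ \forall i\}$, of cardinality $m^d$. With $U(u)=[u^s/s!:|s|\le l]$ and a bandwidth $h\in(0,\rho]$, put $B(x)=\frac1{(mh)^d}\sum_{y\in\mathcal G_m}U(\frac{y-x}h)U(\frac{y-x}h)^{\mathrm T}\prod_jK(\frac{y_j-x_j}h)$ and $$w^\star_y(x)=\Big[\frac1{(mh)^d}\prod_jK\Big(\frac{y_j-x_j}h\Big)B(x)^{-1}U\Big(\frac{y-x}h\Big)\Big]_1 .$$ One step of LPI-GD on a loss with smoothness constant $L$ is $\theta\leftarrow\theta-\frac1L\widehat{\nabla F}(\theta)$, where $\widehat{\nabla F}(\theta)_i=\frac1n\sum_j\sum_{y\in\mathcal G_m}\frac{\partial f}{\partial\theta_i}(y;\theta)\,w^\star_y(x^{(j)})$. It costs $m^d$ oracle calls (evaluations of $\nabla_\theta f(y;\theta)$). The parameters $m,h$ may change from step to step. **Catalyst.** Start with $\theta^{(0)}=z_0=\theta_0$ and $\alpha_0=\sqrt q$. In outer iteration $k\ge1$: * apply $T_k$ steps of LPI-GD, started at $\theta^{(k-1)}$,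 to the loss $f(x;\theta)+\frac\kappa2\|\theta-z_{k-1}\|^2$, whose smoothness constant is $L_1+\kappa=2L_1-\mu$ and whose empirical risk is the surrogate $h_k(\theta)=F(\theta)+\frac\kappa2\|\theta-z_{k-1}\|^2$; call the result $\theta^{(k)}$; * let $\alpha_k\in(0,1)$ solve $\alpha_k^2=(1-\alpha_k)\alpha_{k-1}^2+q\alpha_k$; * put $z_k=\theta^{(k)}+\beta_k(\theta^{(k)}-\theta^{(k-1)})$ with $\beta_k=\frac{\alpha_{k-1}(1-\alpha_{k-1})}{\alpha_{k-1}^2+\alpha_k}$. **Theorem.** For all $0<c_1\le c_2$ there is a constant $A$ depending only on $c_1,c_2$, and for all $d,\eta,L_1,L_2$, every margin $\rho$ and every kernel there is a constant $C$ depending only on these (and on $c_1,c_2$), such that the following holds for all $\mu\in(0,L_1)$, $p$, $\Delta$, every sequence $(\varepsilon_k)_{k\ge1}$ with $$c_1\Big(1-\frac1{3\sqrt\sigma}\Big)^k\Delta\le\varepsilon_k\le c_2\Big(1-\frac1{3\sqrt\sigma}\Big)^k\Delta ,$$ and every $\varepsilon>0$ with $\varepsilon\le\Delta/2$ and $\frac1{q^2}+\frac{p/(2L_1)}{\varepsilon}\ge2$.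 There are a number $K\ge1$ of outer iterations, numbers $T_k$ of inner steps, and grid parameters and bandwidths, all chosen before $n$, the loss, the data and $\theta_0$, such that for every such problem with $F(\theta_0)-F^\star=\Delta$ we have $$h_k(\theta^{(k)})-\inf h_k\le\varepsilon_k\quad(1\le k\le K),\qquad F(\theta^{(K)})-F^\star\le\varepsilon ,$$ with $\varepsilon\le A\,\varepsilon_K/q$. Moreover, let $m$ denote an upper bound for all the grid parameters used, suitably chosen. Then $$m^d\le C\Big(\frac p{\varepsilon_K}+\frac{2L_1}{q^2}\Big)^{\frac d{2\eta}},\quad T_k\le A\log\Big(\frac1{q^2}+\frac{p/(2L_1)}{\varepsilon_K}\Big),\quad K\le A\sqrt\sigma\,\Lambda ,$$ and the total number $N$ of oracle calls satisfies both $$N\le A\sqrt\sigma\,\Lambda\,m^d\log\Big(\frac1{q^2}+\frac{p/(2L_1)}{\varepsilon_K}\Big)$$ (that is, $N=\tilde O(\sqrt\sigma\,m^d\log(1/\varepsilon))$) and $$N\le A\sqrt\sigma\,\Lambda\; C\Big(\frac p{\varepsilon_K}+\frac{2L_1}{q^2}\Big)^{\frac d{2\eta}}\log\Big(\frac1{q^2}+\frac{p/(2L_1)}{\varepsilon_K}\Big),$$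 where $\Lambda=\log\frac{\sigma(F(\theta_0)-F^\star)}{\varepsilon}$. As soon as $\varepsilon\le\Delta/(2\sigma^2)$, all these bounds also hold with $\Lambda=\log\frac{F(\theta_0)-F^\star}{\sigma\varepsilon}$. -/

import Mathlib

open scoped BigOperators

namespace LPI

/-- The parameter space `ℝ^p` with its Euclidean norm. -/
abbrev Param (p : ℕ) := EuclideanSpace ℝ (Fin p)

/-- The unit cube `[0,1]^d`. -/
def cube (d : ℕ) : Set (Fin d → ℝ) := Set.Icc 0 1

/-- The integer `l = ⌈η⌉ - 1`, for `η > 0`. -/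
noncomputable def order (η : ℝ) : ℕ := ⌈η⌉₊ - 1

/-- The `(η, L)`-Hölder class on `[0,1]^d`: `l` times continuously differentiable on the cube
(one-sidedly at the boundary), and every partial derivative of order `l` satisfies
`|∂^s g(y₁) - ∂^s g(y₂)| ≤ L ‖y₁ - y₂‖₁ ^ (η - l)`. A partial derivative of order `l` is given by
the list `ι` of the coordinates along which one differentiates. -/
def HolderClass {d : ℕ} (η L : ℝ) (g : (Fin d → ℝ) → ℝ) : Prop :=
  ContDiffOn ℝ (order η) g (cube d) ∧
  ∀ ι : Fin (order η) → Fin d, ∀ y₁ ∈ cube d, ∀ y₂ ∈ cube d,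
    |iteratedFDerivWithin ℝ (order η) g (cube d) y₁ (fun j => Pi.single (ι j) 1)
      - iteratedFDerivWithin ℝ (order η) g (cube d) y₂ (fun j => Pi.single (ι j) 1)|
      ≤ L * (∑ i, |y₁ i - y₂ i|) ^ (η - (order η : ℝ))

/-- The standing assumptions on the loss `f(x; θ)`, for `x ∈ [0,1]^d` and `θ ∈ ℝ^p`. -/
structure LossAssumptions {d p : ℕ} (μ L₁ L₂ η : ℝ) (f : (Fin d → ℝ) → Param p → ℝ) : Prop where
  differentiable : ∀ x ∈ cube d, Differentiable ℝ (f x)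
  smooth_param : ∀ x ∈ cube d, ∀ θ₁ θ₂ : Param p,
    ‖gradient (f x) θ₁ - gradient (f x) θ₂‖ ≤ L₁ * ‖θ₁ - θ₂‖
  smooth_data : ∀ (ϑ : Param p) (i : Fin p), HolderClass η L₂ (fun y => gradient (f y) ϑ i)
  strong_convex : ∀ x ∈ cube d, ∀ θ₁ θ₂ : Param p,
    f x θ₂ + inner ℝ (gradient (f x) θ₂) (θ₁ - θ₂) + μ / 2 * ‖θ₁ - θ₂‖ ^ 2 ≤ f x θ₁

/-- The empirical risk `F(θ) = (1/n) ∑ⱼ f(x⁽ʲ⁾; θ)`. -/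
noncomputable def risk {d p n : ℕ} (f : (Fin d → ℝ) → Param p → ℝ) (x : Fin n → Fin d → ℝ)
    (θ : Param p) : ℝ :=
  (1 / (n : ℝ)) * ∑ j, f (x j) θ

/-- The optimality gap `G(θ) - inf G`. -/
noncomputable def gap {p : ℕ} (G : Param p → ℝ) (θ : Param p) : ℝ :=
  G θ - (⨅ ϑ, G ϑ)

/-! ### Local polynomial interpolation -/

/-- Interpolation kernels: nonnegative, bounded, supported in `[-1,1]`, and bounded away from zero
near the origin. -/
structure IsKernel (Ker : ℝ → ℝ) : Prop where
  nonneg : ∀ u, 0 ≤ Ker u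
  support : ∀ u, 1 < |u| → Ker u = 0
  bounded : ∃ b : ℝ, ∀ u, Ker u ≤ b
  lower : ∃ c : ℝ, 0 < c ∧ ∀ u, |u| ≤ c → c ≤ Ker u

/-- The uniform grid `{u ∈ [0,1]^d : m uᵢ ∈ {1, …, m} for all i}`. -/
noncomputable def grid (d m : ℕ) : Finset (Fin d → ℝ) :=
  Finset.univ.image (fun a : Fin d → Fin m => fun i => (((a i : ℕ) : ℝ) + 1) / (m : ℝ))

/-- Multi-indices `s ∈ ℕ^d` with `|s| ≤ l`. -/
abbrev MultiIndex (d l : ℕ) := {s : Fin d → Fin (l + 1) // ∑ i, (s i : ℕ) ≤ l}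

/-- The multi-index `0`, the first entry of the vectors below. -/
def zeroIndex (d l : ℕ) : MultiIndex d l := ⟨fun _ => 0, by simp⟩

/-- `U(u) = [u^s / s! : |s| ≤ l]`. -/
noncomputable def monomials {d : ℕ} (l : ℕ) (u : Fin d → ℝ) : MultiIndex d l → ℝ :=
  fun s => ∏ i, u i ^ (s.1 i : ℕ) / ((s.1 i : ℕ).factorial : ℝ)

/-- `∏ⱼ K((yⱼ - xⱼ) / h)`. -/
noncomputable def kernelProd {d : ℕ} (Ker : ℝ → ℝ) (h : ℝ) (x y : Fin d → ℝ) : ℝ :=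
  ∏ i, Ker ((y i - x i) / h)

/-- The matrix `B(x)`. -/
noncomputable def gramMatrix {d : ℕ} (Ker : ℝ → ℝ) (l m : ℕ) (h : ℝ) (x : Fin d → ℝ) :
    Matrix (MultiIndex d l) (MultiIndex d l) ℝ :=
  (1 / ((m : ℝ) * h) ^ d) • ∑ y ∈ grid d m, kernelProd Ker h x y •
    Matrix.vecMulVec (monomials l (fun i => (y i - x i) / h))
      (monomials l (fun i => (y i - x i) / h))

/-- The interpolation weight `w*_y(x) = [w_y(x)]₁`. -/
noncomputable def weight {d : ℕ} (Ker : ℝ → ℝ) (l m : ℕ) (h : ℝ) (x y : Fin d → ℝ) : ℝ :=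
  (1 / ((m : ℝ) * h) ^ d) * kernelProd Ker h x y *
    Matrix.mulVec (gramMatrix Ker l m h x)⁻¹ (monomials l (fun i => (y i - x i) / h))
      (zeroIndex d l)

/-- The approximate gradient: its `i`-th coordinate is the average over the data of
`∑_{y ∈ G_m} ∂f/∂θᵢ(y; θ) w*_y(x⁽ʲ⁾)`. It queries the gradient oracle `∇_θ f(y; θ)` once at every
grid point `y`. -/
noncomputable def approxGradient {d p n : ℕ} (Ker : ℝ → ℝ) (l m : ℕ) (h : ℝ)
    (f : (Fin d → ℝ) → Param p → ℝ) (x : Fin n → Fin d → ℝ) (θ : Param p) : Param p :=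
  WithLp.toLp 2 (fun i => (1 / (n : ℝ)) *
    ∑ j, ∑ y ∈ grid d m, gradient (f y) θ i * weight Ker l m h (x j) y)

/-- LPI-GD for the empirical risk of `f`, with step size `1 / L`, started at `θ₀`: the iterate after
`t` steps. Step `t` uses the grid parameter `m t` and the bandwidth `h t`. -/
noncomputable def lpiGD {d p n : ℕ} (Ker : ℝ → ℝ) (l : ℕ) (L : ℝ) (m : ℕ → ℕ) (h : ℕ → ℝ)
    (f : (Fin d → ℝ) → Param p → ℝ) (x : Fin n → Fin d → ℝ) (θ₀ : Param p) : ℕ → Param p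
  | 0 => θ₀
  | t + 1 => lpiGD Ker l L m h f x θ₀ t
      - (1 / L) • approxGradient Ker l (m t) (h t) f x (lpiGD Ker l L m h f x θ₀ t)

/-! ### Catalyst acceleration -/

/-- Adding the quadratic `(κ/2) ‖θ - z‖²` to the loss. The empirical risk of this loss is the
surrogate `F(θ) + (κ/2) ‖θ - z‖²`. -/
noncomputable def surrogateLoss {d p : ℕ} (κ : ℝ) (z : Param p) (f : (Fin d → ℝ) → Param p → ℝ) :
    (Fin d → ℝ) → Param p → ℝ :=
  fun x θ => f x θ + κ / 2 * ‖θ - z‖ ^ 2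

/-- The surrogate `h(θ) = F(θ) + (κ/2) ‖θ - z‖²`. -/
noncomputable def surrogate {p : ℕ} (κ : ℝ) (z : Param p) (F : Param p → ℝ) (θ : Param p) : ℝ :=
  F θ + κ / 2 * ‖θ - z‖ ^ 2

/-- The solution `α ∈ (0,1)` of `α² = (1 - α) a² + q α`. -/
noncomputable def nextAlpha (q a : ℝ) : ℝ :=
  ((q - a ^ 2) + Real.sqrt ((q - a ^ 2) ^ 2 + 4 * a ^ 2)) / 2

theorem nextAlpha_iff {q a : ℝ} (hq : q < 1) (ha : 0 < a) (α : ℝ) :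
    (α ∈ Set.Ioo (0 : ℝ) 1 ∧ α ^ 2 = (1 - α) * a ^ 2 + q * α) ↔ α = nextAlpha q a := by
  have hD0 : 0 ≤ Real.sqrt ((q - a ^ 2) ^ 2 + 4 * a ^ 2) := Real.sqrt_nonneg _
  have hD : Real.sqrt ((q - a ^ 2) ^ 2 + 4 * a ^ 2) ^ 2 = (q - a ^ 2) ^ 2 + 4 * a ^ 2 :=
    Real.sq_sqrt (by positivity)
  have ha2 : 0 < a ^ 2 := by positivity
  unfold nextAlpha
  set D := Real.sqrt ((q - a ^ 2) ^ 2 + 4 * a ^ 2) with hDdef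
  clear_value D
  have h1 : -(q - a ^ 2) < D := by
    by_contra! h
    nlinarith
  constructor
  · rintro ⟨⟨h0, -⟩, h⟩
    have hprod : (2 * α - (q - a ^ 2) - D) * (2 * α - (q - a ^ 2) + D) = 0 := by
      nlinarith
    rcases mul_eq_zero.mp hprod with h | h
    · linarith
    · exfalso
      have h2 : q - a ^ 2 < D := by
        by_contra! h'
        nlinarith
      linarith
  · rintro rfl
    refine ⟨⟨by linarith, ?_⟩, by nlinarith⟩
    by_contra! h
    nlinarith

/-- The state of the Catalyst iteration: `θ⁽ᵏ⁾`, the extrapolated point `z_k`, and `α_k`. -/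
structure CatalystState (p : ℕ) where
  θ : Param p
  z : Param p
  α : ℝ

/-- The parameters of a run: the number `T k` of LPI-GD steps in outer iteration `k = 1, 2, …`, and
the grid parameter `m k t` and bandwidth `h k t` of its step `t = 0, …, T k - 1`. -/
structure Schedule where
  T : ℕ → ℕ
  m : ℕ → ℕ → ℕ
  h : ℕ → ℕ → ℝ

/-- Catalyst acceleration of LPI-GD, with `κ = L₁ - μ` and `q = μ / (μ + κ)`: the state after `k`
outer iterations. In outer iteration `k`, LPI-GD is applied to the surrogate with center `z_{k-1}`,
whose smoothness constant is `L₁ + κ`, starting from `θ⁽ᵏ⁻¹⁾`. -/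
noncomputable def catalyst {d p n : ℕ} (Ker : ℝ → ℝ) (l : ℕ) (μ L₁ : ℝ) (S : Schedule)
    (f : (Fin d → ℝ) → Param p → ℝ) (x : Fin n → Fin d → ℝ) (θ₀ : Param p) :
    ℕ → CatalystState p
  | 0 => ⟨θ₀, θ₀, Real.sqrt (μ / (μ + (L₁ - μ)))⟩
  | k + 1 =>
    let s := catalyst Ker l μ L₁ S f x θ₀ k
    let κ := L₁ - μ
    let q := μ / (μ + κ)
    let θ' := lpiGD Ker l (L₁ + κ) (S.m (k + 1)) (S.h (k + 1)) (surrogateLoss κ s.z f) x s.θ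
      (S.T (k + 1))
    let α' := nextAlpha q s.α
    let β := s.α * (1 - s.α) / (s.α ^ 2 + α')
    ⟨θ', θ' + β • (θ' - s.θ), α'⟩

/-- The total number of gradient-oracle calls in `K` outer iterations: every LPI-GD step makes one
call at each point of its grid. -/
noncomputable def oracleCalls (d K : ℕ) (S : Schedule) : ℕ :=
  ∑ k ∈ Finset.Icc 1 K, ∑ t ∈ Finset.range (S.T k), (grid d (S.m k t)).card

end LPI

/-!
The proof has two independent halves, tied together by the choice of the parameters.

*Interpolation.* The grid parameter `m` and the bandwidth `h` are tied by `m h = H` for a constant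
`H`. Then every data point has a tensor grid of `(l + 1) ^ d` well separated grid points within its
window. Lagrange interpolation on these nodes recovers each coefficient of a polynomial of degree at
most `l` (`coeff_eq_sum_nodes`); hence the matrix `B(x)` is invertible (`isUnit_det_gramMatrix`), and
its quadratic form controls the value of the polynomial at the origin (`sq_coeff_zero_le`). No
eigenvalue bound is needed: the weights reproduce polynomials because of the first fact, and their
absolute values have a bounded sum because of the second one and the Cauchy–Schwarz inequality
(`sq_sum_abs_weight_le`). The interpolation error of a Hölder function is then a bounded multiple of
its Taylor remainder, of order `h ^ η` (`exists_interpolation_constants`).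

*Optimization.* Strong convexity and smoothness enter only as two-sided quadratic bounds
(`QuadBounds`). The surrogates have condition number at most two, so that a step of LPI-GD halves
their gap up to the interpolation error (`gap_lpiGD_le`). In Catalyst, with `a = √q`, all `α_k` equal
`a`, and with `v_k = θ_{k-1} + (θ_k - θ_{k-1}) / a` the extrapolated point is the average
`(θ_k + a v_k) / (1 + a)`. The potential `S_k = F(θ_k) - F* + (μ / 2) ‖v_k - x*‖ ^ 2` satisfies
`(1 - a / 6) S_k ≤ (1 - a) S_{k-1} + (1 + 6 / a) ε_k` (`QuadBounds.potential_step`), which gives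
`S_k ≤ (B / q) (1 - a / 3) ^ k Δ` with a constant `B` depending only on `c₂`. The gap of the next
surrogate at `θ_k` is at most `5 S_k` (`QuadBounds.gap_warm_start_le`), within a factor of order `1 / q`
of the accuracy required there, so that a number of inner steps of order `1 + log (1 / q)` suffices in
each outer iteration. The same `T` and `m` serve all iterations.
-/

namespace LPI

/-! ### Nodes and Lagrange interpolation -/

open Polynomial in
/-- Interpolation of the monomial `X ^ r` on `l + 1 > r` nodes is exact. -/
theorem sum_pow_mul_coeff_basis {l : ℕ} {t : Fin (l + 1) → ℝ} (ht : Function.Injective t)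
    {r : ℕ} (hr : r ≤ l) (s : ℕ) :
    ∑ j, t j ^ r * (Lagrange.basis Finset.univ t j).coeff s = if s = r then 1 else 0 := by
  have h := Lagrange.eq_interpolate_of_eval_eq (s := Finset.univ) (v := t) (f := (X : ℝ[X]) ^ r)
    (fun j => t j ^ r) ht.injOn (by
      rw [degree_X_pow]; simp; exact_mod_cast Nat.lt_succ_of_le hr) (by intro i _; simp)
  have h2 := congrArg (fun P => coeff P s) h
  simp only [coeff_X_pow, Lagrange.interpolate_apply, finsetSum_coeff, coeff_C_mul] at h2
  exact h2.symm

theorem abs_coeff_zero_basis_le {l : ℕ} {t : Fin (l + 1) → ℝ} {H : ℝ} (hH : 0 < H)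
    (hb : ∀ j, |t j| ≤ 1) (hs : ∀ j k, j ≠ k → 1 / H ≤ |t j - t k|) (j : Fin (l + 1)) :
    |(Lagrange.basis Finset.univ t j).coeff 0| ≤ H ^ l := by
  rw [Polynomial.coeff_zero_eq_eval_zero, Lagrange.basis, Polynomial.eval_prod, Finset.abs_prod]
  have hc : (Finset.univ.erase j).card = l := by simp
  calc _ ≤ ∏ k ∈ Finset.univ.erase j, H := by
        refine Finset.prod_le_prod (fun _ _ => abs_nonneg _) fun k hk => ?_
        have hjk := hs j k (Finset.ne_of_mem_erase hk).symm
        simp only [Lagrange.basisDivisor, Polynomial.eval_mul, Polynomial.eval_C,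
          Polynomial.eval_sub, Polynomial.eval_X, zero_sub, abs_mul, abs_inv, abs_neg]
        have h1 : |t j - t k|⁻¹ ≤ H := by
          rw [inv_le_comm₀ (lt_of_lt_of_le (by positivity) hjk) hH, ← one_div]; exact hjk
        calc _ ≤ H * 1 := by gcongr; exact hb k
          _ = H := mul_one H
    _ = H ^ l := by simp [hc]

/-- The coefficients of a polynomial of degree at most `l` are linear combinations of its values on a
tensor grid of `l + 1` nodes per coordinate. -/
theorem coeff_eq_sum_nodes {d l : ℕ} {t : Fin d → Fin (l + 1) → ℝ}
    (ht : ∀ i, Function.Injective (t i)) (v : MultiIndex d l → ℝ) (s : MultiIndex d l) :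
    ∑ J : Fin d → Fin (l + 1), (v ⬝ᵥ monomials l (fun i => t i (J i))) *
      ∏ i, (Lagrange.basis Finset.univ (t i) (J i)).coeff (s.1 i)
      = v s / ∏ i, ((s.1 i : ℕ).factorial : ℝ) := by
  simp only [dotProduct, Finset.sum_mul]
  rw [Finset.sum_comm]
  have key : ∀ r : MultiIndex d l, ∑ J : Fin d → Fin (l + 1),
      v r * monomials l (fun i => t i (J i)) r *
        ∏ i, (Lagrange.basis Finset.univ (t i) (J i)).coeff (s.1 i)
      = v r * if r = s then 1 / ∏ i, ((s.1 i : ℕ).factorial : ℝ) else 0 := by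
    intro r
    simp only [mul_assoc, ← Finset.mul_sum]
    congr 1
    simp only [monomials, ← Finset.prod_mul_distrib]
    have h := (Finset.prod_univ_sum (R := ℝ) (fun _ : Fin d => (Finset.univ : Finset (Fin (l + 1))))
      (fun i j => t i j ^ (r.1 i : ℕ) / ((r.1 i : ℕ).factorial : ℝ) *
        (Lagrange.basis Finset.univ (t i) j).coeff (s.1 i))).symm
    rw [Fintype.piFinset_univ] at h
    rw [h]
    have h2 : ∀ i, ∑ j, t i j ^ (r.1 i : ℕ) / ((r.1 i : ℕ).factorial : ℝ) *
        (Lagrange.basis Finset.univ (t i) j).coeff (s.1 i)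
        = (if (s.1 i : ℕ) = r.1 i then 1 else 0) / ((r.1 i : ℕ).factorial : ℝ) := by
      intro i
      rw [← sum_pow_mul_coeff_basis (ht i) (Nat.lt_succ_iff.mp (r.1 i).2), Finset.sum_div]
      exact Finset.sum_congr rfl fun j _ => by ring
    simp only [h2]
    split_ifs with hrs
    · subst hrs; simp
    · obtain ⟨i, hi⟩ : ∃ i, (s.1 i : ℕ) ≠ r.1 i := by
        by_contra! hcon
        exact hrs (Subtype.ext (funext fun i => Fin.ext (hcon i).symm))
      exact Finset.prod_eq_zero (Finset.mem_univ i) (by simp [hi])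
  simp only [key]
  simp [div_eq_mul_inv]

/-- `B(x)` as a bilinear form: a weighted sum of products of polynomial values over the grid. -/
theorem dotProduct_gramMatrix {d : ℕ} (Ker : ℝ → ℝ) (l m : ℕ) (h : ℝ) (x : Fin d → ℝ)
    (a v : MultiIndex d l → ℝ) :
    a ⬝ᵥ (gramMatrix Ker l m h x).mulVec v = 1 / ((m : ℝ) * h) ^ d * ∑ y ∈ grid d m,
      kernelProd Ker h x y * (a ⬝ᵥ monomials l (fun i => (y i - x i) / h)) *
        (v ⬝ᵥ monomials l (fun i => (y i - x i) / h)) := by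
  rw [gramMatrix, Matrix.smul_mulVec, dotProduct_smul, Matrix.sum_mulVec, dotProduct_sum,
    smul_eq_mul]
  congr 1
  refine Finset.sum_congr rfl fun y _ => ?_
  rw [Matrix.smul_mulVec, dotProduct_smul, Matrix.vecMulVec_mulVec, smul_eq_mul]
  rw [dotProduct_smul, MulOpposite.smul_eq_mul_unop, MulOpposite.unop_op, dotProduct_comm _ v]
  ring

/-- Around every data point the grid contains a tensor grid of `(l + 1) ^ d` nodes, which in the
rescaled coordinates lie in `[-c, c]^d` and are `1 / (m h)`-separated in each coordinate. -/
theorem exists_nodes {d l m : ℕ} {c h ρ : ℝ} {x : Fin d → ℝ} (hc : 0 < c) (hc1 : c ≤ 1 / 2)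
    (hm : 0 < m) (hh : 0 < h) (hhρ : h ≤ ρ) (hmh : (l + 1) / c ≤ m * h)
    (hx : ∀ i, x i ∈ Set.Icc ρ (1 - ρ)) :
    ∃ t : Fin d → Fin (l + 1) → ℝ,
      (∀ i j, |t i j| ≤ c) ∧ (∀ i j k, j ≠ k → 1 / (m * h) ≤ |t i j - t i k|) ∧
      ∀ J : Fin d → Fin (l + 1), (fun i => x i + h * t i (J i)) ∈ grid d m := by
  have hm' : (0 : ℝ) < m := by exact_mod_cast hm
  have hH : 0 < (m : ℝ) * h := by positivity
  have hb : ∀ i (j : Fin (l + 1)), |((⌊m * x i⌋ + (j : ℕ) : ℝ) - m * x i) / (m * h)| ≤ c := by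
    intro i j
    rw [abs_div, abs_of_pos hH, div_le_iff₀ hH]
    have h1 := Int.floor_le ((m : ℝ) * x i)
    have h2 := Int.lt_floor_add_one ((m : ℝ) * x i)
    have h3 : ((j : ℕ) : ℝ) ≤ l := by exact_mod_cast Nat.lt_succ_iff.mp j.2
    have h4 : (0 : ℝ) ≤ (j : ℕ) := by positivity
    rw [div_le_iff₀ hc] at hmh
    rw [abs_le]; constructor <;> nlinarith
  refine ⟨fun i j => ((⌊m * x i⌋ + (j : ℕ) : ℝ) - m * x i) / (m * h), hb, ?_, ?_⟩
  · intro i j k hjk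
    rw [← sub_div, abs_div, abs_of_pos hH]
    gcongr
    have h1 : (1 : ℤ) ≤ |((j : ℕ) : ℤ) - (k : ℕ)| := by
      apply Int.one_le_abs
      intro h0
      exact hjk (Fin.ext (by omega))
    have h2 : (1 : ℝ) ≤ |((j : ℕ) : ℝ) - (k : ℕ)| := by exact_mod_cast h1
    calc (1 : ℝ) ≤ |((j : ℕ) : ℝ) - (k : ℕ)| := h2
      _ = _ := by congr 1; ring
  · intro J
    have hy : ∀ i, x i + h * (((⌊m * x i⌋ + ((J i : ℕ)) : ℝ) - m * x i) / (m * h))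
        = ((⌊m * x i⌋ + ((J i : ℕ) : ℤ) : ℤ) : ℝ) / m := by
      intro i; push_cast; field_simp; ring
    have hpos : ∀ i, 0 < ⌊m * x i⌋ + ((J i : ℕ) : ℤ) ∧ ⌊m * x i⌋ + ((J i : ℕ) : ℤ) ≤ m := by
      intro i
      have h1 := abs_le.mp (hb i (J i))
      have h2 := hx i
      have h3 := hy i
      set τ := ((⌊m * x i⌋ + ((J i : ℕ)) : ℝ) - m * x i) / (m * h)
      have h4 : 0 < x i + h * τ := by nlinarith [h2.1]
      have h5 : x i + h * τ ≤ 1 := by nlinarith [h2.2]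
      rw [h3] at h4 h5
      rw [div_le_one hm'] at h5
      constructor
      · have := (div_pos_iff_of_pos_right hm').mp h4
        exact_mod_cast this
      · exact_mod_cast h5
    simp only [grid, Finset.mem_image, Finset.mem_univ, true_and]
    refine ⟨fun i => ⟨(⌊m * x i⌋ + ((J i : ℕ) : ℤ) - 1).toNat, by have := hpos i; omega⟩, ?_⟩
    funext i
    rw [hy i]
    have h6 : (((⌊m * x i⌋ + ((J i : ℕ) : ℤ) - 1).toNat : ℕ) : ℤ) + 1
        = ⌊m * x i⌋ + ((J i : ℕ) : ℤ) := by have := hpos i; omega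
    rw [← h6]; push_cast; rfl

/-- The quadratic form of `gramMatrix` dominates the sum of squares of a polynomial over nodes. -/
theorem sum_nodes_sq_le {d l m : ℕ} {Ker : ℝ → ℝ} {c h : ℝ} {x : Fin d → ℝ}
    {t : Fin d → Fin (l + 1) → ℝ} (hK : ∀ u, 0 ≤ Ker u) (hc : 0 < c) (hcK : ∀ u, |u| ≤ c → c ≤ Ker u)
    (hm : 0 < m) (hh : 0 < h) (htb : ∀ i j, |t i j| ≤ c) (ht : ∀ i, Function.Injective (t i))
    (htg : ∀ J : Fin d → Fin (l + 1), (fun i => x i + h * t i (J i)) ∈ grid d m)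
    (v : MultiIndex d l → ℝ) :
    ∑ J : Fin d → Fin (l + 1), (v ⬝ᵥ monomials l (fun i => t i (J i))) ^ 2
      ≤ (m * h / c) ^ d * (v ⬝ᵥ (gramMatrix Ker l m h x).mulVec v) := by
  have hm' : (0 : ℝ) < m := by exact_mod_cast hm
  rw [dotProduct_gramMatrix]
  have hu : ∀ J : Fin d → Fin (l + 1), (fun i => (x i + h * t i (J i) - x i) / h)
      = fun i => t i (J i) := by
    intro J; funext i; field_simp; ring
  have hinj : Function.Injective
      (fun (J : Fin d → Fin (l + 1)) i => x i + h * t i (J i)) := by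
    intro J J' hJ
    funext i
    have := congrFun hJ i
    simp only [add_right_inj] at this
    exact ht i (mul_left_cancel₀ hh.ne' this)
  have h1 : ∑ J : Fin d → Fin (l + 1), c ^ d * (v ⬝ᵥ monomials l (fun i => t i (J i))) ^ 2
      ≤ ∑ y ∈ grid d m,
      kernelProd Ker h x y * (v ⬝ᵥ monomials l (fun i => (y i - x i) / h)) *
        (v ⬝ᵥ monomials l (fun i => (y i - x i) / h)) := by
    calc _ ≤ ∑ J : Fin d → Fin (l + 1), kernelProd Ker h x (fun i => x i + h * t i (J i)) *
          (v ⬝ᵥ monomials l (fun i => (x i + h * t i (J i) - x i) / h)) *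
          (v ⬝ᵥ monomials l (fun i => (x i + h * t i (J i) - x i) / h)) := by
          refine Finset.sum_le_sum fun J _ => ?_
          rw [hu, mul_assoc, ← sq]
          refine mul_le_mul_of_nonneg_right ?_ (sq_nonneg _)
          have : c ^ d = ∏ _i : Fin d, c := by simp
          rw [this, kernelProd]
          refine Finset.prod_le_prod (fun _ _ => hc.le) fun i _ => hcK _ ?_
          rw [congrFun (hu J) i]; exact htb i _
      _ = ∑ y ∈ Finset.univ.image (fun (J : Fin d → Fin (l + 1)) i => x i + h * t i (J i)),
          kernelProd Ker h x y * (v ⬝ᵥ monomials l (fun i => (y i - x i) / h)) *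
          (v ⬝ᵥ monomials l (fun i => (y i - x i) / h)) := by
          rw [Finset.sum_image hinj.injOn]
      _ ≤ _ := by
          refine Finset.sum_le_sum_of_subset_of_nonneg ?_ fun y _ _ => ?_
          · intro y hy
            obtain ⟨J, -, rfl⟩ := Finset.mem_image.mp hy
            exact htg J
          · rw [mul_assoc, ← sq]
            exact mul_nonneg (Finset.prod_nonneg fun _ _ => hK _) (sq_nonneg _)
  rw [← Finset.mul_sum] at h1
  rw [← mul_assoc, div_pow]
  have h2 : (m * h : ℝ) ^ d / c ^ d * (1 / (m * h) ^ d) = 1 / c ^ d := by field_simp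
  rw [h2, one_div, ← div_eq_inv_mul, le_div_iff₀ (by positivity)]
  linarith

/-! ### Taylor expansion of Hölder functions on the cube -/

theorem uniqueDiffOn_Icc_pi {d : ℕ} {a b : Fin d → ℝ} (hab : ∀ i, a i < b i) :
    UniqueDiffOn ℝ (Set.Icc a b) := by
  rw [← Set.pi_univ_Icc]
  exact UniqueDiffOn.univ_pi fun i => uniqueDiffOn_Icc (hab i)

theorem line_mem_cube {d : ℕ} {x v : Fin d → ℝ} (hx : x ∈ cube d) (hv : x + v ∈ cube d) {t : ℝ}
    (ht : t ∈ Set.Icc (0 : ℝ) 1) : x + t • v ∈ cube d :=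
  (convex_Icc (0 : Fin d → ℝ) 1).add_smul_mem hx hv ht

theorem contDiffOn_line {d : ℕ} {N : ℕ} {g : (Fin d → ℝ) → ℝ} (hg : ContDiffOn ℝ N g (cube d))
    {x v : Fin d → ℝ} (hx : x ∈ cube d) (hv : x + v ∈ cube d) :
    ContDiffOn ℝ N (fun t : ℝ => g (x + t • v)) (Set.Icc 0 1) :=
  hg.comp (by fun_prop) fun _ ht => line_mem_cube hx hv ht

open scoped Pointwise in
/-- The chain rule for iterated derivatives along a segment of the cube, one-sided at the boundary. -/
theorem iteratedDerivWithin_line {d : ℕ} {N : ℕ} {g : (Fin d → ℝ) → ℝ}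
    (hg : ContDiffOn ℝ N g (cube d)) {x v : Fin d → ℝ} (hx : x ∈ cube d) (hv : x + v ∈ cube d)
    {j : ℕ} (hj : j ≤ N) {t : ℝ} (ht : t ∈ Set.Icc (0 : ℝ) 1) :
    iteratedDerivWithin j (fun t : ℝ => g (x + t • v)) (Set.Icc 0 1) t
      = iteratedFDerivWithin ℝ j g (cube d) (x + t • v) fun _ => v := by
  set s' : Set (Fin d → ℝ) := -x +ᵥ cube d with hs'
  have hmem : ∀ z, z ∈ s' ↔ x + z ∈ cube d := by
    intro z; rw [hs', Set.mem_vadd_set_iff_neg_vadd_mem]; simp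
  have hxs : x +ᵥ s' = cube d := by rw [hs', vadd_vadd]; simp
  have hud : UniqueDiffOn ℝ s' := by
    have : s' = Set.Icc (-x) (1 - x) := by
      ext z
      rw [hmem, cube, Set.mem_Icc, Set.mem_Icc, neg_le_iff_add_nonneg', le_sub_iff_add_le']
    rw [this]
    exact uniqueDiffOn_Icc_pi fun i => by simp only [Pi.neg_apply, Pi.sub_apply, Pi.one_apply]; linarith
  have hG : ContDiffOn ℝ N (fun z => g (x + z)) s' :=
    hg.comp (by fun_prop) fun z hz => (hmem z).mp hz
  have hT := ((hG.of_le (m := j) (by exact_mod_cast hj)).ftaylorSeriesWithin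
    hud).compContinuousLinearMap (ContinuousLinearMap.toSpanSingleton ℝ v)
  have hT' := hT.mono (s := _) (t := Set.Icc (0 : ℝ) 1) fun u hu =>
    (hmem _).mpr (by simpa using line_mem_cube hx hv hu)
  have h := hT'.eq_iteratedFDerivWithin_of_uniqueDiffOn le_rfl (uniqueDiffOn_Icc one_pos) ht
  rw [iteratedDerivWithin]
  change iteratedFDerivWithin ℝ j ((fun z => g (x + z)) ∘ ContinuousLinearMap.toSpanSingleton ℝ v)
    _ _ _ = _
  rw [← h]
  simp [ftaylorSeriesWithin, iteratedFDerivWithin_comp_add_left, hxs]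

/-- A multilinear form on the diagonal, expanded in the standard basis. -/
theorem multilinear_diagonal {d j : ℕ} (D : ContinuousMultilinearMap ℝ (fun _ : Fin j => Fin d → ℝ) ℝ)
    (v : Fin d → ℝ) :
    D (fun _ => v) = ∑ ι : Fin j → Fin d, (∏ k, v (ι k)) * D (fun k => Pi.single (ι k) 1) := by
  have hv : v = ∑ i, v i • (Pi.single i (1 : ℝ) : Fin d → ℝ) := pi_eq_sum_univ' v
  conv_lhs => rw [hv]
  have h := D.toMultilinearMap.map_sum (fun (_ : Fin j) i => v i • (Pi.single i (1 : ℝ) : Fin d → ℝ))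
  simp only [ContinuousMultilinearMap.coe_coe] at h
  rw [h]
  refine Finset.sum_congr rfl fun ι _ => ?_
  have := D.toMultilinearMap.map_smul_univ (fun k => v (ι k))
    (fun k => (Pi.single (ι k) (1 : ℝ) : Fin d → ℝ))
  simpa using this

theorem order_lt {η : ℝ} (hη : 0 < η) : (order η : ℝ) < η := by
  have h1 := Nat.ceil_lt_add_one hη.le
  have h2 : 1 ≤ ⌈η⌉₊ := Nat.one_le_ceil_iff.mpr hη
  rw [order, Nat.cast_sub h2]; push_cast; linarith

/-- Along a segment of direction `v`, the `l`-th derivative moves by at most `L ‖v‖₁ ^ η`. -/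
theorem HolderClass.diagonal_sub_le {d : ℕ} {η L : ℝ} {g : (Fin d → ℝ) → ℝ} (hη : 0 < η)
    (hL : 0 ≤ L) (hg : HolderClass η L g) {x v : Fin d → ℝ} (hx : x ∈ cube d) (hv : x + v ∈ cube d)
    {t : ℝ} (ht : t ∈ Set.Icc (0 : ℝ) 1) :
    |iteratedFDerivWithin ℝ (order η) g (cube d) (x + t • v) (fun _ => v)
      - iteratedFDerivWithin ℝ (order η) g (cube d) x (fun _ => v)| ≤ L * (∑ i, |v i|) ^ η := by
  have hlt := order_lt hη
  have hv0 : 0 ≤ ∑ i, |v i| := Finset.sum_nonneg fun _ _ => abs_nonneg _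
  rw [multilinear_diagonal, multilinear_diagonal, ← Finset.sum_sub_distrib]
  have hsum : ∑ i, |(x + t • v) i - x i| ≤ ∑ i, |v i| := by
    refine Finset.sum_le_sum fun i _ => ?_
    simp only [Pi.add_apply, Pi.smul_apply, smul_eq_mul, add_sub_cancel_left, abs_mul,
      abs_of_nonneg ht.1]
    exact mul_le_of_le_one_left (abs_nonneg _) ht.2
  have hsum0 : 0 ≤ ∑ i, |(x + t • v) i - x i| := Finset.sum_nonneg fun _ _ => abs_nonneg _
  calc _ ≤ ∑ ι : Fin (order η) → Fin d, (∏ k, |v (ι k)|) * (L * (∑ i, |v i|) ^ (η - order η)) := by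
        refine (Finset.abs_sum_le_sum_abs _ _).trans (Finset.sum_le_sum fun ι _ => ?_)
        rw [← mul_sub, abs_mul, Finset.abs_prod]
        refine mul_le_mul_of_nonneg_left ?_ (Finset.prod_nonneg fun _ _ => abs_nonneg _)
        refine (hg.2 ι _ (line_mem_cube hx hv ht) _ hx).trans ?_
        gcongr
    _ = (∑ i, |v i|) ^ (order η) * (L * (∑ i, |v i|) ^ (η - order η)) := by
        rw [← Finset.sum_mul]
        congr 1
        have := (Finset.prod_univ_sum (R := ℝ) (fun _ : Fin (order η) => (Finset.univ : Finset (Fin d)))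
          (fun _ i => |v i|)).symm
        rw [Fintype.piFinset_univ] at this
        rw [this]; simp
    _ = L * (∑ i, |v i|) ^ η := by
        rw [mul_left_comm, ← Real.rpow_natCast, ← Real.rpow_add_of_nonneg hv0 (by positivity)
          (by linarith)]
        congr 2; ring

/-- Taylor's theorem on the cube. The Lagrange remainder of order `l - 1` contains the `l`-th derivative
at an intermediate point, which is compared with the one at `x`. -/
theorem HolderClass.taylor_le {d : ℕ} {η L : ℝ} {g : (Fin d → ℝ) → ℝ} (hη : 0 < η)
    (hL : 0 ≤ L) (hg : HolderClass η L g) {x v : Fin d → ℝ} (hx : x ∈ cube d)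
    (hv : x + v ∈ cube d) :
    |g (x + v) - ∑ j ∈ Finset.range (order η + 1), (1 / (j.factorial : ℝ)) *
      iteratedFDerivWithin ℝ j g (cube d) x (fun _ => v)| ≤ L * (∑ i, |v i|) ^ η := by
  have hD := fun t ht => hg.diagonal_sub_le hη hL hx hv (t := t) ht
  have hc := hg.1
  rcases hN : order η with _ | N
  · rw [hN] at hD
    simpa using hD 1 (by simp)
  · rw [hN] at hD hc
    have hcl := contDiffOn_line hc hx hv
    have h01 : Set.uIcc (0 : ℝ) 1 = Set.Icc 0 1 := Set.uIcc_of_le zero_le_one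
    have h01' : Set.uIoo (0 : ℝ) 1 = Set.Ioo 0 1 := Set.uIoo_of_le zero_le_one
    obtain ⟨ξ, hξ, hrem⟩ := taylor_mean_remainder_lagrange (f := fun t : ℝ => g (x + t • v))
      (x := 1) (x₀ := 0) (n := N) zero_ne_one
      (by rw [h01]; exact hcl.of_le (by exact_mod_cast Nat.le_succ N))
      (by
        rw [h01, h01']
        exact (hcl.differentiableOn_iteratedDerivWithin (by exact_mod_cast Nat.lt_succ_self N)
          (uniqueDiffOn_Icc one_pos)).mono Set.Ioo_subset_Icc_self)
    rw [h01] at hrem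
    rw [h01'] at hξ
    have hξ' := Set.Ioo_subset_Icc_self hξ
    rw [taylor_within_apply, iteratedDerivWithin_line hc hx hv le_rfl hξ'] at hrem
    rw [Finset.sum_range_succ]
    have hsum : ∑ k ∈ Finset.range (N + 1), (((k.factorial : ℝ))⁻¹ * ((1 : ℝ) - 0) ^ k) •
        iteratedDerivWithin k (fun t : ℝ => g (x + t • v)) (Set.Icc 0 1) 0
        = ∑ k ∈ Finset.range (N + 1), (1 / (k.factorial : ℝ)) *
          iteratedFDerivWithin ℝ k g (cube d) x (fun _ => v) := by
      refine Finset.sum_congr rfl fun k hk => ?_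
      rw [iteratedDerivWithin_line hc hx hv (Finset.mem_range.mp hk).le (by simp)]
      simp
    rw [hsum] at hrem
    simp only [one_smul, sub_zero, one_pow, mul_one] at hrem
    have hf1 : (1 : ℝ) ≤ ((N + 1).factorial : ℝ) := by exact_mod_cast Nat.one_le_iff_ne_zero.mpr (Nat.factorial_ne_zero _)
    have hfin : ∀ a b c e F : ℝ, 1 ≤ F → a - b = c / F → |c - e| ≤ L * (∑ i, |v i|) ^ η →
        |a - (b + 1 / F * e)| ≤ L * (∑ i, |v i|) ^ η := by
      intro a b c e F hF h1 h2
      have : a - (b + 1 / F * e) = (c - e) / F := by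
        rw [sub_div, ← h1]; ring
      rw [this, abs_div, abs_of_pos (by linarith : (0 : ℝ) < F)]
      exact (div_le_self (abs_nonneg _) hF).trans h2
    exact hfin _ _ _ _ _ hf1 hrem (hD ξ hξ')

/-! ### Interpolation weights and the interpolation error -/

/-- A vector in the kernel of `B(x)` is the coefficient vector of a polynomial that vanishes on all nodes. -/
theorem isUnit_det_gramMatrix {d l m : ℕ} {Ker : ℝ → ℝ} {c h : ℝ} {x : Fin d → ℝ}
    {t : Fin d → Fin (l + 1) → ℝ} (hK : ∀ u, 0 ≤ Ker u) (hc : 0 < c) (hcK : ∀ u, |u| ≤ c → c ≤ Ker u)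
    (hm : 0 < m) (hh : 0 < h) (htb : ∀ i j, |t i j| ≤ c) (ht : ∀ i, Function.Injective (t i))
    (htg : ∀ J : Fin d → Fin (l + 1), (fun i => x i + h * t i (J i)) ∈ grid d m) :
    IsUnit (gramMatrix Ker l m h x).det := by
  rw [isUnit_iff_ne_zero]
  intro hdet
  obtain ⟨v, hv0, hv⟩ := Matrix.exists_mulVec_eq_zero_iff.mpr hdet
  have h := sum_nodes_sq_le hK hc hcK hm hh htb ht htg v
  rw [hv, dotProduct_zero, mul_zero] at h
  have hz := (Finset.sum_eq_zero_iff_of_nonneg fun J _ => sq_nonneg _).mp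
    (le_antisymm h (Finset.sum_nonneg fun _ _ => sq_nonneg _))
  apply hv0
  funext s
  have hs := coeff_eq_sum_nodes ht v s
  rw [Finset.sum_eq_zero fun J hJ => by rw [pow_eq_zero_iff two_ne_zero |>.mp (hz J hJ), zero_mul]]
    at hs
  have hf : ∏ i, ((s.1 i : ℕ).factorial : ℝ) ≠ 0 :=
    Finset.prod_ne_zero_iff.mpr fun i _ => by exact_mod_cast Nat.factorial_ne_zero _
  exact (div_eq_zero_iff.mp hs.symm).resolve_right hf

/-- The value at the origin of a polynomial of degree at most `l` is controlled by the quadratic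
form of `gramMatrix`. -/
theorem sq_coeff_zero_le {d l m : ℕ} {Ker : ℝ → ℝ} {c h : ℝ} {x : Fin d → ℝ}
    {t : Fin d → Fin (l + 1) → ℝ} (hK : ∀ u, 0 ≤ Ker u) (hc : 0 < c) (hc1 : c ≤ 1)
    (hcK : ∀ u, |u| ≤ c → c ≤ Ker u)
    (hm : 0 < m) (hh : 0 < h) (htb : ∀ i j, |t i j| ≤ c)
    (hsep : ∀ i j k, j ≠ k → 1 / (m * h) ≤ |t i j - t i k|)
    (ht : ∀ i, Function.Injective (t i))
    (htg : ∀ J : Fin d → Fin (l + 1), (fun i => x i + h * t i (J i)) ∈ grid d m)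
    (v : MultiIndex d l → ℝ) :
    v (zeroIndex d l) ^ 2 ≤ ((l + 1) ^ d * ((m * h) ^ l) ^ d * ((m * h) ^ l) ^ d * (m * h / c) ^ d)
      * (v ⬝ᵥ (gramMatrix Ker l m h x).mulVec v) := by
  have hm' : (0 : ℝ) < m := by exact_mod_cast hm
  have h0 := coeff_eq_sum_nodes ht v (zeroIndex d l)
  have hf : ∏ i, (((zeroIndex d l).1 i : ℕ).factorial : ℝ) = 1 := by simp [zeroIndex]
  rw [hf, div_one] at h0
  have hQ := sum_nodes_sq_le hK hc hcK hm hh htb ht htg v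
  rw [← h0]
  calc _ ≤ (∑ J : Fin d → Fin (l + 1), (v ⬝ᵥ monomials l (fun i => t i (J i))) ^ 2) *
        ∑ J : Fin d → Fin (l + 1),
          (∏ i, (Lagrange.basis Finset.univ (t i) (J i)).coeff ((zeroIndex d l).1 i)) ^ 2 :=
        Finset.sum_mul_sq_le_sq_mul_sq _ _ _
    _ ≤ ((m * h / c) ^ d * (v ⬝ᵥ (gramMatrix Ker l m h x).mulVec v)) *
        ∑ _J : Fin d → Fin (l + 1), (((m * h : ℝ) ^ l) ^ d) ^ 2 := by
        refine mul_le_mul hQ (Finset.sum_le_sum fun J _ => ?_)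
          (Finset.sum_nonneg fun _ _ => sq_nonneg _)
          (le_trans (Finset.sum_nonneg fun _ _ => sq_nonneg _) hQ)
        rw [sq_le_sq, Finset.abs_prod, abs_of_nonneg (a := (((m : ℝ) * h) ^ l) ^ d) (by positivity)]
        calc _ ≤ ∏ _i : Fin d, (m * h : ℝ) ^ l := by
              refine Finset.prod_le_prod (fun _ _ => abs_nonneg _) fun i _ => ?_
              exact abs_coeff_zero_basis_le (by positivity) (fun j => (htb i j).trans hc1)
                (hsep i) (J i)
          _ = _ := by simp
    _ = _ := by
        simp only [Finset.sum_const, Finset.card_univ, Fintype.card_pi, Fintype.card_fin,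
          Finset.prod_const, nsmul_eq_mul]
        push_cast; ring

/-- The weights reproduce polynomials of degree at most `l`. -/
theorem sum_weight_mul_monomials {d l m : ℕ} {Ker : ℝ → ℝ} {h : ℝ} {x : Fin d → ℝ}
    (hB : IsUnit (gramMatrix Ker l m h x).det) (s : MultiIndex d l) :
    ∑ y ∈ grid d m, weight Ker l m h x y * monomials l (fun i => (y i - x i) / h) s
      = if s = zeroIndex d l then 1 else 0 := by
  have h1 := dotProduct_gramMatrix Ker l m h x ((gramMatrix Ker l m h x)⁻¹ (zeroIndex d l))
    (Pi.single s 1)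
  rw [Matrix.dotProduct_mulVec] at h1
  have h2 : Matrix.vecMul ((gramMatrix Ker l m h x)⁻¹ (zeroIndex d l)) (gramMatrix Ker l m h x)
      = (1 : Matrix _ _ ℝ) (zeroIndex d l) := by
    rw [← Matrix.nonsing_inv_mul _ hB]; rfl
  rw [h2] at h1
  simp only [dotProduct_single, mul_one, single_dotProduct, one_mul, Matrix.one_apply] at h1
  simp only [eq_comm (a := s)]
  rw [h1, Finset.mul_sum]
  refine Finset.sum_congr rfl fun y _ => ?_
  rw [weight, Matrix.mulVec]
  ring

/-- The window of a data point contains at most `2 m h + 1` grid points per coordinate. -/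
theorem sum_kernel_le {m : ℕ} {Ker : ℝ → ℝ} {b h u : ℝ} (hK0 : ∀ u, 0 ≤ Ker u)
    (hKs : ∀ u, 1 < |u| → Ker u = 0) (hKb : ∀ u, Ker u ≤ b) (hm : 0 < m) (hh : 0 < h) :
    ∑ a : Fin m, Ker (((((a : ℕ) : ℝ) + 1) / m - u) / h) ≤ b * (2 * (m * h) + 1) := by
  have hm' : (0 : ℝ) < m := by exact_mod_cast hm
  have hb : 0 ≤ b := (hK0 0).trans (hKb 0)
  set A := Finset.univ.filter fun a : Fin m => |((((a : ℕ) : ℝ) + 1) / m - u) / h| ≤ 1 with hA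
  have h1 : ∑ a : Fin m, Ker (((((a : ℕ) : ℝ) + 1) / m - u) / h)
      = ∑ a ∈ A, Ker (((((a : ℕ) : ℝ) + 1) / m - u) / h) := by
    rw [hA, Finset.sum_filter]
    refine Finset.sum_congr rfl fun a _ => ?_
    split_ifs with hle
    · rfl
    · exact hKs _ (not_le.mp hle)
  have hcard : (A.card : ℝ) ≤ 2 * (m * h) + 1 := by
    have hle : A.card ≤ (Finset.Icc ⌈m * u - m * h⌉ ⌊m * u + m * h⌋).card := by
      refine Finset.card_le_card_of_injOn (fun a => ((a : ℕ) : ℤ) + 1) ?_ ?_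
      · intro a ha
        have ha' := (Finset.mem_filter.mp ha).2
        rw [abs_div, abs_of_pos hh, div_le_one hh, abs_le] at ha'
        have e : (m : ℝ) * ((((a : ℕ) : ℝ) + 1) / m) = ((a : ℕ) : ℝ) + 1 := by field_simp
        simp only [Finset.coe_Icc, Set.mem_Icc]
        constructor
        · rw [Int.ceil_le]; push_cast; nlinarith [ha'.1]
        · rw [Int.le_floor]; push_cast; nlinarith [ha'.2]
      · intro a _ a' _ h
        apply Fin.ext
        simpa using h
    rw [Int.card_Icc] at hle
    have h3 : (A.card : ℝ) ≤ (((⌊m * u + m * h⌋ + 1 - ⌈m * u - m * h⌉).toNat : ℕ) : ℝ) := by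
      exact_mod_cast hle
    refine h3.trans ?_
    rcases le_total 0 (⌊m * u + m * h⌋ + 1 - ⌈m * u - m * h⌉) with h4 | h4
    · have h5 : (((⌊m * u + m * h⌋ + 1 - ⌈m * u - m * h⌉).toNat : ℕ) : ℝ)
          = ((⌊m * u + m * h⌋ + 1 - ⌈m * u - m * h⌉ : ℤ) : ℝ) := by
        exact_mod_cast congrArg (Int.cast (R := ℝ)) (Int.toNat_of_nonneg h4)
      rw [h5]; push_cast
      linarith [Int.floor_le (m * u + m * h), Int.le_ceil (m * u - m * h)]
    · rw [Int.toNat_of_nonpos h4]; push_cast; positivity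
  rw [h1]
  calc _ ≤ ∑ _a ∈ A, b := Finset.sum_le_sum fun a _ => hKb _
    _ = b * A.card := by rw [Finset.sum_const, nsmul_eq_mul, mul_comm]
    _ ≤ _ := by gcongr

theorem sum_kernelProd_le {d m : ℕ} {Ker : ℝ → ℝ} {b h : ℝ} {x : Fin d → ℝ} (hK0 : ∀ u, 0 ≤ Ker u)
    (hKs : ∀ u, 1 < |u| → Ker u = 0) (hKb : ∀ u, Ker u ≤ b) (hm : 0 < m) (hh : 0 < h) :
    ∑ y ∈ grid d m, kernelProd Ker h x y ≤ (b * (2 * (m * h) + 1)) ^ d := by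
  have hm' : (m : ℝ) ≠ 0 := by exact_mod_cast hm.ne'
  have hinj : Function.Injective
      (fun a : Fin d → Fin m => fun i => (((a i : ℕ) : ℝ) + 1) / (m : ℝ)) := by
    intro a a' haa
    funext i
    have := congrFun haa i
    simp only at this
    rw [div_left_inj' hm', add_left_inj] at this
    exact Fin.ext (by exact_mod_cast this)
  rw [grid, Finset.sum_image hinj.injOn]
  simp only [kernelProd]
  have hprod := (Finset.prod_univ_sum (R := ℝ) (fun _ : Fin d => (Finset.univ : Finset (Fin m)))
    (fun i a => Ker (((((a : ℕ) : ℝ) + 1) / m - x i) / h))).symm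
  rw [Fintype.piFinset_univ] at hprod
  rw [hprod]
  calc _ ≤ ∏ _i : Fin d, (b * (2 * ((m : ℝ) * h) + 1)) :=
        Finset.prod_le_prod (fun i _ => Finset.sum_nonneg fun _ _ => hK0 _)
          fun i _ => sum_kernel_le hK0 hKs hKb hm hh
    _ = _ := by simp

/-- Cauchy–Schwarz with weights `kernelProd`. For the polynomial `P` with coefficient vector `a`, the
first row of `B(x)⁻¹`, the sum of the weighted `P ^ 2` is `aᵀ B(x) a = P(0) = a₀`, and the bound
`a₀ ^ 2 ≤ G a₀` gives `a₀ ≤ G`. -/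
theorem sq_sum_abs_weight_le {d l m : ℕ} {Ker : ℝ → ℝ} {h G : ℝ} {x : Fin d → ℝ}
    (hK0 : ∀ u, 0 ≤ Ker u) (hm : 0 < m) (hh : 0 < h) (hG : 0 ≤ G)
    (hB : IsUnit (gramMatrix Ker l m h x).det)
    (hq : ∀ v : MultiIndex d l → ℝ,
      v (zeroIndex d l) ^ 2 ≤ G * (v ⬝ᵥ (gramMatrix Ker l m h x).mulVec v)) :
    (∑ y ∈ grid d m, |weight Ker l m h x y|) ^ 2
      ≤ 1 / ((m : ℝ) * h) ^ d * (∑ y ∈ grid d m, kernelProd Ker h x y) * G := by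
  have hm' : (0 : ℝ) < m := by exact_mod_cast hm
  set a := (gramMatrix Ker l m h x)⁻¹ (zeroIndex d l) with ha
  have haB : a ⬝ᵥ (gramMatrix Ker l m h x).mulVec a = a (zeroIndex d l) := by
    rw [Matrix.dotProduct_mulVec]
    have h2 : Matrix.vecMul a (gramMatrix Ker l m h x) = (1 : Matrix _ _ ℝ) (zeroIndex d l) := by
      rw [← Matrix.nonsing_inv_mul _ hB]; rfl
    rw [h2]
    simp [dotProduct, Matrix.one_apply]
  have ha0 : a (zeroIndex d l) ≤ G := by
    have := hq a
    rw [haB] at this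
    by_contra! hcon
    nlinarith
  have hk : ∀ y, 0 ≤ kernelProd Ker h x y := fun y => Finset.prod_nonneg fun _ _ => hK0 _
  have hform := dotProduct_gramMatrix Ker l m h x a a
  rw [haB] at hform
  have hw : ∀ y, |weight Ker l m h x y| = 1 / ((m : ℝ) * h) ^ d * kernelProd Ker h x y *
      |a ⬝ᵥ monomials l (fun i => (y i - x i) / h)| := by
    intro y
    rw [weight, abs_mul, abs_of_nonneg (mul_nonneg (by positivity) (hk y))]
    rfl
  simp only [hw]
  calc _ ≤ (∑ y ∈ grid d m, 1 / ((m : ℝ) * h) ^ d * kernelProd Ker h x y) *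
        ∑ y ∈ grid d m, 1 / ((m : ℝ) * h) ^ d * (kernelProd Ker h x y *
          (a ⬝ᵥ monomials l (fun i => (y i - x i) / h)) *
          (a ⬝ᵥ monomials l (fun i => (y i - x i) / h))) := by
        refine Finset.sum_sq_le_sum_mul_sum_of_sq_le_mul _
          (fun y _ => mul_nonneg (by positivity) (hk y)) (fun y _ => ?_) fun y _ => le_of_eq ?_
        · rw [mul_assoc (kernelProd _ _ _ _)]
          exact mul_nonneg (by positivity) (mul_nonneg (hk y) (mul_self_nonneg _))
        · rw [mul_pow, sq_abs]; ring
    _ = (1 / ((m : ℝ) * h) ^ d * ∑ y ∈ grid d m, kernelProd Ker h x y) * a (zeroIndex d l) := by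
        rw [← Finset.mul_sum, ← Finset.mul_sum, ← hform]
    _ ≤ _ := by
        refine mul_le_mul_of_nonneg_left ha0 (mul_nonneg (by positivity)
          (Finset.sum_nonneg fun y _ => hk y))

theorem monomials_zeroIndex {d : ℕ} (l : ℕ) (u : Fin d → ℝ) : monomials l u (zeroIndex d l) = 1 := by
  simp [monomials, zeroIndex]

/-- The multi-index counting how often each coordinate occurs in a list of at most `l`
coordinates. -/
def countIndex {d l j : ℕ} (hj : j ≤ l) (ι : Fin j → Fin d) : MultiIndex d l :=
  ⟨fun i => ⟨(Finset.univ.filter fun k => ι k = i).card,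
    Nat.lt_succ_of_le (((Finset.card_filter_le _ _).trans (by simp)).trans hj)⟩, by
    have h := Finset.card_eq_sum_card_fiberwise (f := ι) (s := Finset.univ) (t := Finset.univ)
      (fun _ _ => Finset.mem_coe.mpr (Finset.mem_univ _))
    simp only [Finset.card_univ, Fintype.card_fin] at h
    simpa [← h] using hj⟩

/-- A product of coordinates along a list is a multiple of an entry of `U`. -/
theorem prod_eq_factorial_mul_monomials {d l j : ℕ} (hj : j ≤ l) (ι : Fin j → Fin d)
    (u : Fin d → ℝ) :
    ∏ k, u (ι k) = (∏ i, (((countIndex hj ι).1 i : ℕ).factorial : ℝ)) *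
      monomials l u (countIndex hj ι) := by
  rw [monomials, ← Finset.prod_mul_distrib]
  have h := Finset.prod_fiberwise' (Finset.univ : Finset (Fin j)) ι u
  rw [← h]
  refine Finset.prod_congr rfl fun i _ => ?_
  rw [Finset.prod_const]
  have : (((countIndex hj ι).1 i : ℕ).factorial : ℝ) ≠ 0 := by
    exact_mod_cast Nat.factorial_ne_zero _
  field_simp
  rfl

theorem sum_weight_mul_prod {d l m j : ℕ} {Ker : ℝ → ℝ} {h : ℝ} {x : Fin d → ℝ}
    (hB : IsUnit (gramMatrix Ker l m h x).det) (hh : 0 < h) (hj : j ≤ l) (ι : Fin j → Fin d) :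
    ∑ y ∈ grid d m, weight Ker l m h x y * ∏ k, (y (ι k) - x (ι k)) = if j = 0 then 1 else 0 := by
  have h1 : ∀ y : Fin d → ℝ, ∏ k, (y (ι k) - x (ι k)) = h ^ j *
      ((∏ i, (((countIndex hj ι).1 i : ℕ).factorial : ℝ)) *
        monomials l (fun i => (y i - x i) / h) (countIndex hj ι)) := by
    intro y
    rw [← prod_eq_factorial_mul_monomials hj ι]
    have : h ^ j = ∏ _k : Fin j, h := by simp
    rw [this, ← Finset.prod_mul_distrib]
    exact Finset.prod_congr rfl fun k _ => by field_simp
  have h2 : ∀ y : Fin d → ℝ, weight Ker l m h x y * ∏ k, (y (ι k) - x (ι k)) = h ^ j *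
      (∏ i, (((countIndex hj ι).1 i : ℕ).factorial : ℝ)) * (weight Ker l m h x y *
        monomials l (fun i => (y i - x i) / h) (countIndex hj ι)) := by
    intro y; rw [h1]; ring
  simp only [h2]
  rw [← Finset.mul_sum, sum_weight_mul_monomials hB]
  rcases Nat.eq_zero_or_pos j with rfl | hjp
  · have : countIndex hj ι = zeroIndex d l := by
      apply Subtype.ext; funext i; apply Fin.ext
      simp [countIndex, zeroIndex]
    rw [if_pos this, this]
    simp [zeroIndex]
  · have : countIndex hj ι ≠ zeroIndex d l := by
      intro hcon
      have h3 := congrArg (fun s : MultiIndex d l => (s.1 (ι ⟨0, hjp⟩) : ℕ)) hcon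
      simp only [countIndex, zeroIndex, Fin.val_zero] at h3
      have h4 := Finset.card_eq_zero.mp h3
      exact Finset.notMem_empty (⟨0, hjp⟩ : Fin j) (h4 ▸ by simp)
    rw [if_neg this, if_neg hjp.ne', mul_zero]

theorem grid_subset_cube {d m : ℕ} {y : Fin d → ℝ} (hy : y ∈ grid d m) : y ∈ cube d := by
  simp only [grid, Finset.mem_image, Finset.mem_univ, true_and] at hy
  obtain ⟨a, rfl⟩ := hy
  rw [cube, Set.mem_Icc]
  constructor
  · intro i; simp only [Pi.zero_apply]; positivity
  · intro i
    simp only [Pi.one_apply]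
    have h := (a i).2
    have hm : (0 : ℝ) < m := by exact_mod_cast (Nat.zero_le _).trans_lt h
    rw [div_le_one hm]
    exact_mod_cast h

theorem abs_sub_le_of_weight_ne_zero {d l m : ℕ} {Ker : ℝ → ℝ} {h : ℝ} {x y : Fin d → ℝ}
    (hKs : ∀ u, 1 < |u| → Ker u = 0) (hh : 0 < h) (hw : weight Ker l m h x y ≠ 0) (i : Fin d) :
    |y i - x i| ≤ h := by
  by_contra! hcon
  apply hw
  have : kernelProd Ker h x y = 0 := Finset.prod_eq_zero (Finset.mem_univ i)
    (hKs _ (by rw [abs_div, abs_of_pos hh, one_lt_div hh]; exact hcon))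
  rw [weight, this]; ring

/-- Interpolation error of a Hölder function: the Taylor polynomial is reproduced exactly, so only
the Taylor remainder, weighted by the absolute values of the weights, is left. -/
theorem HolderClass.interpolation_error_le {d m : ℕ} {η L h W : ℝ} {Ker : ℝ → ℝ}
    {g : (Fin d → ℝ) → ℝ} {x : Fin d → ℝ} (hη : 0 < η) (hL : 0 ≤ L) (hg : HolderClass η L g)
    (hKs : ∀ u, 1 < |u| → Ker u = 0) (hh : 0 < h) (hx : x ∈ cube d)
    (hB : IsUnit (gramMatrix Ker (order η) m h x).det)
    (hW : ∑ y ∈ grid d m, |weight Ker (order η) m h x y| ≤ W) :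
    |(∑ y ∈ grid d m, g y * weight Ker (order η) m h x y) - g x| ≤ W * (L * (d * h) ^ η) := by
  set T : (Fin d → ℝ) → ℝ := fun y => ∑ j ∈ Finset.range (order η + 1), (1 / (j.factorial : ℝ)) *
      iteratedFDerivWithin ℝ j g (cube d) x (fun _ => y - x) with hT
  have hrep : ∑ y ∈ grid d m, T y * weight Ker (order η) m h x y = g x := by
    simp only [hT, Finset.sum_mul]
    rw [Finset.sum_comm]
    have hj : ∀ j ∈ Finset.range (order η + 1), ∑ y ∈ grid d m, 1 / (j.factorial : ℝ) *
        iteratedFDerivWithin ℝ j g (cube d) x (fun _ => y - x) * weight Ker (order η) m h x y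
        = if j = 0 then g x else 0 := by
      intro j hj
      have hj' : j ≤ order η := Nat.lt_succ_iff.mp (Finset.mem_range.mp hj)
      simp only [multilinear_diagonal, Finset.mul_sum, Finset.sum_mul, Pi.sub_apply]
      rw [Finset.sum_comm]
      have hι : ∀ ι : Fin j → Fin d, ∑ y ∈ grid d m, 1 / (j.factorial : ℝ) *
          ((∏ k, (y (ι k) - x (ι k))) *
            iteratedFDerivWithin ℝ j g (cube d) x (fun k => Pi.single (ι k) 1)) *
          weight Ker (order η) m h x y = 1 / (j.factorial : ℝ) *
            iteratedFDerivWithin ℝ j g (cube d) x (fun k => Pi.single (ι k) 1) *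
            if j = 0 then 1 else 0 := by
        intro ι
        rw [← sum_weight_mul_prod hB hh hj' ι, Finset.mul_sum]
        exact Finset.sum_congr rfl fun y _ => by ring
      simp only [hι]
      split_ifs with h0
      · subst h0; simp
      · simp
    rw [Finset.sum_congr rfl hj]
    simp
  have herr : (∑ y ∈ grid d m, g y * weight Ker (order η) m h x y) - g x
      = ∑ y ∈ grid d m, (g y - T y) * weight Ker (order η) m h x y := by
    rw [← hrep, ← Finset.sum_sub_distrib]
    exact Finset.sum_congr rfl fun y _ => by ring
  rw [herr]
  have hR : 0 ≤ L * ((d : ℝ) * h) ^ η := by positivity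
  calc _ ≤ ∑ y ∈ grid d m, (L * ((d : ℝ) * h) ^ η) * |weight Ker (order η) m h x y| := by
        refine (Finset.abs_sum_le_sum_abs _ _).trans (Finset.sum_le_sum fun y hy => ?_)
        rw [abs_mul]
        by_cases hw : weight Ker (order η) m h x y = 0
        · simp [hw]
        refine mul_le_mul_of_nonneg_right ?_ (abs_nonneg _)
        have ht := hg.taylor_le hη hL (v := y - x) hx
          (by rw [add_sub_cancel]; exact grid_subset_cube hy)
        rw [add_sub_cancel] at ht
        refine ht.trans ?_
        gcongr
        calc _ ≤ ∑ _i : Fin d, h := Finset.sum_le_sum fun i _ =>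
              abs_sub_le_of_weight_ne_zero hKs hh hw i
          _ = d * h := by simp
    _ = (L * ((d : ℝ) * h) ^ η) * ∑ y ∈ grid d m, |weight Ker (order η) m h x y| := by
        rw [Finset.mul_sum]
    _ ≤ _ := by rw [mul_comm]; gcongr

/-- If grid and bandwidth are tied by `m h = H` for a suitable constant `H`, then the weights sum to
one and the interpolation error is of order `h ^ η`, uniformly in everything else. -/
theorem exists_interpolation_constants (d : ℕ) {η L : ℝ} {Ker : ℝ → ℝ} (hη : 0 < η) (hL : 0 < L)
    (hKer : IsKernel Ker) :
    ∃ H W : ℝ, 0 < H ∧ 0 < W ∧ ∀ (m : ℕ) (h ρ : ℝ) (x : Fin d → ℝ), 0 < m → 0 < h → h ≤ ρ →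
      m * h = H → (∀ i, x i ∈ Set.Icc ρ (1 - ρ)) →
      ∑ y ∈ grid d m, weight Ker (order η) m h x y = 1 ∧
      ∀ g, HolderClass η L g →
        |(∑ y ∈ grid d m, g y * weight Ker (order η) m h x y) - g x| ≤ W * h ^ η := by
  obtain ⟨b, hb⟩ := hKer.bounded
  obtain ⟨c₀, hc₀, hlow⟩ := hKer.lower
  set l := order η with hl
  set c := min c₀ (1 / 2) with hcdef
  have hc : 0 < c := lt_min hc₀ (by norm_num)
  have hc1 : c ≤ 1 / 2 := min_le_right _ _
  have hcK : ∀ u, |u| ≤ c → c ≤ Ker u := fun u hu =>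
    (min_le_left _ _).trans (hlow u (hu.trans (min_le_left _ _)))
  set H : ℝ := (l + 1) / c with hH
  have hHpos : 0 < H := by positivity
  set G : ℝ := (l + 1) ^ d * (H ^ l) ^ d * (H ^ l) ^ d * (H / c) ^ d with hG
  have hGpos : 0 < G := by positivity
  set V : ℝ := 1 / H ^ d * (b * (2 * H + 1)) ^ d * G with hV
  refine ⟨H, (Real.sqrt V + 1) * (L * ((d : ℝ) ^ η + 1)), hHpos, by positivity, ?_⟩
  intro m h ρ x hm hh hhρ hmh hx
  obtain ⟨t, htb, hsep, htg⟩ := exists_nodes (l := l) hc hc1 hm hh hhρ (by rw [hmh]) hx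
  have hm' : (0 : ℝ) < m := by exact_mod_cast hm
  have htinj : ∀ i, Function.Injective (t i) := by
    intro i j k hjk
    by_contra hne
    have := hsep i j k hne
    rw [hjk, sub_self, abs_zero, hmh] at this
    have h2 : 0 < 1 / H := by positivity
    linarith
  have hB := isUnit_det_gramMatrix hKer.nonneg hc hcK hm hh htb htinj htg
  have hq := sq_coeff_zero_le hKer.nonneg hc (by linarith) hcK hm hh htb hsep htinj htg
  rw [hmh] at hq
  have hsq := sq_sum_abs_weight_le hKer.nonneg hm hh hGpos.le hB hq
  rw [hmh] at hsq
  have hWb : ∑ y ∈ grid d m, |weight Ker l m h x y| ≤ Real.sqrt V := by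
    apply Real.le_sqrt_of_sq_le
    refine hsq.trans ?_
    rw [hV]
    have := sum_kernelProd_le (x := x) (d := d) hKer.nonneg hKer.support hb hm hh
    rw [hmh] at this
    gcongr
  have hxc : x ∈ cube d := by
    rw [cube, Set.mem_Icc]
    constructor
    · intro i; have := (hx i).1; simp only [Pi.zero_apply]; linarith
    · intro i; have := (hx i).2; simp only [Pi.one_apply]; linarith
  constructor
  · have := sum_weight_mul_monomials hB (zeroIndex d l)
    simpa only [monomials_zeroIndex, mul_one, if_true] using this
  · intro g hg
    refine (hg.interpolation_error_le hη hL.le hKer.support hh hxc hB hWb).trans ?_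
    rw [Real.mul_rpow (by positivity) hh.le]
    have h1 : 0 ≤ h ^ η := by positivity
    have h2 : 0 ≤ (d : ℝ) ^ η := by positivity
    have h3 := Real.sqrt_nonneg V
    calc _ = Real.sqrt V * (L * (d : ℝ) ^ η) * h ^ η := by ring
      _ ≤ _ := by gcongr <;> linarith

/-! ### Inexact gradient descent on the surrogates -/

/-- The two-sided quadratic bounds satisfied by an `m`-strongly convex, `L`-smooth function `F` with
gradient `g`. They are all that the analysis of the optimization methods uses. -/
structure QuadBounds {p : ℕ} (m L : ℝ) (F : Param p → ℝ) (g : Param p → Param p) : Prop where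
  lower : ∀ x y, F y + inner ℝ (g y) (x - y) + m / 2 * ‖x - y‖ ^ 2 ≤ F x
  upper : ∀ x y, F x ≤ F y + inner ℝ (g y) (x - y) + L / 2 * ‖x - y‖ ^ 2

/-- The descent lemma. -/
theorem le_of_lipschitz_gradient {p : ℕ} {L : ℝ} {φ : Param p → ℝ} (hφ : Differentiable ℝ φ)
    (hL : ∀ a b, ‖gradient φ a - gradient φ b‖ ≤ L * ‖a - b‖) (x y : Param p) :
    φ x ≤ φ y + inner ℝ (gradient φ y) (x - y) + L / 2 * ‖x - y‖ ^ 2 := by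
  set v := x - y with hv
  have hd : ∀ t : ℝ, HasDerivAt
      (fun t : ℝ => φ (y + t • v) - (t * inner ℝ (gradient φ y) v + L / 2 * t ^ 2 * ‖v‖ ^ 2))
      (inner ℝ (gradient φ (y + t • v)) v
        - (1 * inner ℝ (gradient φ y) v + L / 2 * (2 * t) * ‖v‖ ^ 2)) t := by
    intro t
    have h1 : HasDerivAt (fun t : ℝ => y + t • v) v t := by
      simpa using ((hasDerivAt_id t).smul_const v).const_add y
    have h2 := (hφ (y + t • v)).hasGradientAt.hasFDerivAt.comp_hasDerivAt t h1
    simp only [InnerProductSpace.toDual_apply_apply] at h2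
    have h3 : HasDerivAt (fun t : ℝ => t ^ 2) (2 * t) t := by simpa using hasDerivAt_pow 2 t
    exact h2.sub (((hasDerivAt_id t).mul_const _).add ((h3.const_mul _).mul_const _))
  have hanti := antitoneOn_of_deriv_nonpos (convex_Icc (0 : ℝ) 1)
    (fun t _ => (hd t).continuousAt.continuousWithinAt)
    (fun t _ => (hd t).differentiableAt.differentiableWithinAt) (by
      intro t ht
      rw [interior_Icc] at ht
      rw [(hd t).deriv]
      have h1 := hL (y + t • v) y
      rw [add_sub_cancel_left, norm_smul, Real.norm_eq_abs, abs_of_pos ht.1] at h1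
      have h2 := real_inner_le_norm (gradient φ (y + t • v) - gradient φ y) v
      rw [inner_sub_left] at h2
      nlinarith [norm_nonneg v])
  have h := hanti (Set.left_mem_Icc.mpr zero_le_one) (Set.right_mem_Icc.mpr zero_le_one) zero_le_one
  simp only [one_smul, zero_smul, add_zero, hv, add_sub_cancel] at h
  linarith

namespace QuadBounds

variable {p : ℕ} {m L : ℝ} {F : Param p → ℝ} {g : Param p → Param p}

theorem add_quadratic (hF : QuadBounds m L F g) (κ : ℝ) (z : Param p) :
    QuadBounds (m + κ) (L + κ) (surrogate κ z F) (fun θ => g θ + κ • (θ - z)) := by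
  have key : ∀ x y : Param p, κ / 2 * ‖x - z‖ ^ 2
      = κ / 2 * ‖y - z‖ ^ 2 + κ * inner ℝ (y - z) (x - y) + κ / 2 * ‖x - y‖ ^ 2 := by
    intro x y
    have : x - z = (y - z) + (x - y) := by abel
    rw [this, norm_add_sq_real]; ring
  constructor
  · intro x y
    have h1 := hF.lower x y
    simp only [LPI.surrogate, inner_add_left, real_inner_smul_left]
    rw [key x y]; linarith
  · intro x y
    have h1 := hF.upper x y
    simp only [LPI.surrogate, inner_add_left, real_inner_smul_left]
    rw [key x y]; linarith

/-- The Polyak–Łojasiewicz inequality. -/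
theorem sub_le_sq_norm (hF : QuadBounds m L F g) (hm : 0 < m) (x y : Param p) :
    2 * m * (F y - F x) ≤ ‖g y‖ ^ 2 := by
  have h1 := hF.lower x y
  have h2 := neg_le_of_abs_le (abs_real_inner_le_norm (g y) (x - y))
  nlinarith [sq_nonneg (‖g y‖ - m * ‖x - y‖)]

theorem exists_min (hF : QuadBounds m L F g) (hm : 0 < m) (hc : Continuous F) :
    ∃ xs, ∀ x, F xs ≤ F x := by
  -- outside this ball around the origin, `F` exceeds `F 0`
  obtain ⟨xs, -, hxs⟩ := (isCompact_closedBall (0 : Param p) (2 * ‖g 0‖ / m)).exists_isMinOn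
    ⟨0, Metric.mem_closedBall_self (by positivity)⟩ hc.continuousOn
  refine ⟨xs, fun x => ?_⟩
  by_cases hx : x ∈ Metric.closedBall (0 : Param p) (2 * ‖g 0‖ / m)
  · exact hxs hx
  · rw [mem_closedBall_zero_iff, not_le, div_lt_iff₀ hm] at hx
    have h0 : F xs ≤ F 0 := hxs (Metric.mem_closedBall_self (by positivity))
    have h1 := hF.lower x 0
    rw [sub_zero] at h1
    have h2 := neg_le_of_abs_le (abs_real_inner_le_norm (g 0) x)
    nlinarith [norm_nonneg x]

theorem growth (hF : QuadBounds m L F g) (hL : 0 < L) {xs : Param p} (hxs : ∀ x, F xs ≤ F x)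
    (x : Param p) : F xs + m / 2 * ‖x - xs‖ ^ 2 ≤ F x := by
  -- a gradient step from a minimizer cannot decrease `F`
  have h0 : g xs = 0 := by
    have h1 := (hxs (xs - (1 / L) • g xs)).trans (hF.upper (xs - (1 / L) • g xs) xs)
    rw [sub_sub_cancel_left, inner_neg_right, real_inner_smul_right, real_inner_self_eq_norm_sq,
      norm_neg, norm_smul, mul_pow, Real.norm_eq_abs, sq_abs] at h1
    have h2 : L / 2 * ((1 / L) ^ 2 * ‖g xs‖ ^ 2) = 1 / L * ‖g xs‖ ^ 2 / 2 := by field_simp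
    rw [h2] at h1
    have h3 : 1 / L * ‖g xs‖ ^ 2 ≤ 0 := by linarith
    have h4 : ‖g xs‖ ^ 2 ≤ 0 := by
      by_contra! hcon
      have : 0 < 1 / L * ‖g xs‖ ^ 2 := by positivity
      linarith
    have h5 : ‖g xs‖ = 0 := by nlinarith [norm_nonneg (g xs)]
    exact norm_eq_zero.mp h5
  have h := hF.lower x xs
  rw [h0, inner_zero_left] at h
  linarith

theorem convex_combination (hF : QuadBounds m L F g) {a : ℝ} (h0 : 0 ≤ a) (h1 : a ≤ 1)
    (x y : Param p) :
    F (a • x + (1 - a) • y) ≤ a * F x + (1 - a) * F y - m / 2 * (a * (1 - a)) * ‖x - y‖ ^ 2 := by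
  set w := a • x + (1 - a) • y with hw
  have hx : x - w = (1 - a) • (x - y) := by rw [hw]; module
  have hy : y - w = (-a) • (x - y) := by rw [hw]; module
  have e1 := hF.lower x w
  have e2 := hF.lower y w
  rw [hx, real_inner_smul_right, norm_smul, mul_pow, Real.norm_eq_abs, sq_abs] at e1
  rw [hy, real_inner_smul_right, norm_smul, mul_pow, Real.norm_eq_abs, sq_abs] at e2
  nlinarith [mul_le_mul_of_nonneg_left e1 h0, mul_le_mul_of_nonneg_left e2 (sub_nonneg.mpr h1)]

/-- One step of inexact gradient descent, with error `e` in the gradient. -/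
theorem inexact_step (hF : QuadBounds m L F g) (hm : 0 < m) (hL : 0 < L) (hLm : L ≤ 2 * m)
    {xs : Param p} (hxs : ∀ x, F xs ≤ F x) (θ e : Param p) {δ : ℝ} (he : ‖e‖ ^ 2 ≤ δ) :
    F (θ - (1 / L) • (g θ + e)) - F xs ≤ (F θ - F xs) / 2 + δ / (2 * L) := by
  have h1 := hF.upper (θ - (1 / L) • (g θ + e)) θ
  have h2 := hF.sub_le_sq_norm hm xs θ
  have h3 : L * (F (θ - (1 / L) • (g θ + e)) - F θ) ≤ (‖e‖ ^ 2 - ‖g θ‖ ^ 2) / 2 := by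
    rw [sub_sub_cancel_left, inner_neg_right, real_inner_smul_right, norm_neg, norm_smul, mul_pow,
      Real.norm_eq_abs, sq_abs, inner_add_right, real_inner_self_eq_norm_sq, norm_add_sq_real] at h1
    have h4 := mul_le_mul_of_nonneg_left h1 hL.le
    have h5 : L * (F θ + -(1 / L * (‖g θ‖ ^ 2 + inner ℝ (g θ) e)) + L / 2 * ((1 / L) ^ 2 *
        (‖g θ‖ ^ 2 + 2 * inner ℝ (g θ) e + ‖e‖ ^ 2))) = L * F θ + (‖e‖ ^ 2 - ‖g θ‖ ^ 2) / 2 := by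
      field_simp; ring
    linarith
  have h6 := hxs θ
  have h7 : (F θ - F xs) / 2 + δ / (2 * L) = (L * (F θ - F xs) + δ) / (2 * L) := by
    field_simp
  rw [h7, le_div_iff₀ (by positivity)]
  nlinarith

end QuadBounds

theorem gap_eq {p : ℕ} {F : Param p → ℝ} {xs : Param p} (hxs : ∀ x, F xs ≤ F x) (θ : Param p) :
    gap F θ = F θ - F xs := by
  have : ⨅ ϑ, F ϑ = F xs :=
    le_antisymm (ciInf_le ⟨F xs, Set.forall_mem_range.mpr hxs⟩ xs) (le_ciInf hxs)
  rw [gap, this]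

/-- The gradient of the empirical risk. -/
noncomputable def riskGradient {d p n : ℕ} (f : (Fin d → ℝ) → Param p → ℝ) (x : Fin n → Fin d → ℝ)
    (θ : Param p) : Param p :=
  (1 / (n : ℝ)) • ∑ j, gradient (f (x j)) θ

section Risk

variable {d p n : ℕ} {μ L₁ L₂ η : ℝ} {f : (Fin d → ℝ) → Param p → ℝ} {x : Fin n → Fin d → ℝ}

theorem LossAssumptions.quadBounds (hf : LossAssumptions μ L₁ L₂ η f) (hn : 0 < n)
    (hx : ∀ j, x j ∈ cube d) : QuadBounds μ L₁ (risk f x) (riskGradient f x) := by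
  have hn' : (0 : ℝ) < n := by exact_mod_cast hn
  have avg : ∀ (θ₁ θ₂ : Param p) (c : ℝ),
      risk f x θ₂ + inner ℝ (riskGradient f x θ₂) (θ₁ - θ₂) + c
      = (1 / (n : ℝ)) * ∑ j, (f (x j) θ₂ + inner ℝ (gradient (f (x j)) θ₂) (θ₁ - θ₂) + c) := by
    intro θ₁ θ₂ c
    rw [risk, riskGradient, real_inner_smul_left, sum_inner, Finset.sum_add_distrib,
      Finset.sum_add_distrib, Finset.sum_const, Finset.card_univ, Fintype.card_fin, nsmul_eq_mul]
    field_simp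
  constructor
  · intro θ₁ θ₂
    rw [avg, risk]
    gcongr with j
    exact hf.strong_convex _ (hx j) _ _
  · intro θ₁ θ₂
    rw [avg, risk]
    gcongr with j
    exact le_of_lipschitz_gradient (hf.differentiable _ (hx j)) (hf.smooth_param _ (hx j)) _ _

theorem LossAssumptions.continuous_risk (hf : LossAssumptions μ L₁ L₂ η f)
    (hx : ∀ j, x j ∈ cube d) : Continuous (risk f x) :=
  continuous_const.mul (continuous_finsetSum _ fun j _ => (hf.differentiable _ (hx j)).continuous)

theorem gradient_surrogateLoss (hf : LossAssumptions μ L₁ L₂ η f) (κ : ℝ) (z θ : Param p)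
    {y : Fin d → ℝ} (hy : y ∈ cube d) :
    gradient (surrogateLoss κ z f y) θ = gradient (f y) θ + κ • (θ - z) := by
  apply HasGradientAt.gradient
  have h1 := (hf.differentiable y hy θ).hasGradientAt.hasFDerivAt
  have h2 : HasFDerivAt (fun θ : Param p => κ / 2 * ‖θ - z‖ ^ 2) _ θ :=
    (((hasFDerivAt_id θ).sub_const z).norm_sq).const_mul (κ / 2)
  rw [hasGradientAt_iff_hasFDerivAt]
  refine (h1.add h2).congr_fderiv ?_
  ext v
  simp
  ring

/-- The error of the approximate gradient of the surrogate. As the weights sum to one, the quadratic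
term is differentiated exactly. -/
theorem sq_norm_approxGradient_sub_le {Ker : ℝ → ℝ} {l m : ℕ} {h E κ : ℝ}
    (hf : LossAssumptions μ L₁ L₂ η f) (hn : 0 < n) (hE : 0 ≤ E)
    (hw1 : ∀ j, ∑ y ∈ grid d m, weight Ker l m h (x j) y = 1)
    (herr : ∀ j, ∀ g, HolderClass η L₂ g →
      |(∑ y ∈ grid d m, g y * weight Ker l m h (x j) y) - g (x j)| ≤ E) (z θ : Param p) :
    ‖approxGradient Ker l m h (surrogateLoss κ z f) x θ - (riskGradient f x θ + κ • (θ - z))‖ ^ 2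
      ≤ p * E ^ 2 := by
  have hn' : (0 : ℝ) < n := by exact_mod_cast hn
  rw [EuclideanSpace.norm_sq_eq]
  calc _ ≤ ∑ _i : Fin p, E ^ 2 := by
        refine Finset.sum_le_sum fun i _ => ?_
        rw [Real.norm_eq_abs, sq_le_sq, abs_abs, abs_of_nonneg hE]
        have h1 : (approxGradient Ker l m h (surrogateLoss κ z f) x θ
            - (riskGradient f x θ + κ • (θ - z))) i = (1 / (n : ℝ)) * ∑ j,
            ((∑ y ∈ grid d m, gradient (f y) θ i * weight Ker l m h (x j) y)
              - gradient (f (x j)) θ i) := by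
          have h2 : ∀ j, ∑ y ∈ grid d m, gradient (surrogateLoss κ z f y) θ i *
              weight Ker l m h (x j) y = (∑ y ∈ grid d m, gradient (f y) θ i *
              weight Ker l m h (x j) y) + κ * (θ i - z i) := by
            intro j
            rw [← mul_one (κ * (θ i - z i)), ← hw1 j, Finset.mul_sum, ← Finset.sum_add_distrib]
            refine Finset.sum_congr rfl fun y hy => ?_
            rw [gradient_surrogateLoss hf κ z θ (grid_subset_cube hy)]
            simp only [PiLp.add_apply, PiLp.smul_apply, PiLp.sub_apply, smul_eq_mul]
            ring
          simp only [approxGradient, riskGradient, PiLp.sub_apply, PiLp.add_apply, PiLp.smul_apply,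
            smul_eq_mul, h2, Finset.sum_add_distrib, Finset.sum_sub_distrib, Finset.sum_const,
            Finset.card_univ, Fintype.card_fin, nsmul_eq_mul, WithLp.ofLp_sum, Finset.sum_apply]
          field_simp
          ring
        rw [h1, abs_mul, abs_of_pos (by positivity : 0 < 1 / (n : ℝ))]
        calc _ ≤ 1 / (n : ℝ) * ∑ _j : Fin n, E := by
              gcongr
              refine (Finset.abs_sum_le_sum_abs _ _).trans (Finset.sum_le_sum fun j _ => ?_)
              exact herr j _ (hf.smooth_data θ i)
          _ = E := by simp; field_simp
    _ = p * E ^ 2 := by simp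

/-- LPI-GD on a surrogate of condition number at most two halves the gap in every step, up to the
accumulated interpolation error. -/
theorem gap_lpiGD_le {Ker : ℝ → ℝ} {l m : ℕ} {h E κ : ℝ}
    (hf : LossAssumptions μ L₁ L₂ η f) (hn : 0 < n) (hx : ∀ j, x j ∈ cube d) (hE : 0 ≤ E)
    (hw1 : ∀ j, ∑ y ∈ grid d m, weight Ker l m h (x j) y = 1)
    (herr : ∀ j, ∀ g, HolderClass η L₂ g →
      |(∑ y ∈ grid d m, g y * weight Ker l m h (x j) y) - g (x j)| ≤ E)
    (hm : 0 < μ + κ) (hL : 0 < L₁ + κ) (hLm : L₁ + κ ≤ 2 * (μ + κ)) (z θ₀ : Param p) (T : ℕ) :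
    gap (surrogate κ z (risk f x))
      (lpiGD Ker l (L₁ + κ) (fun _ => m) (fun _ => h) (surrogateLoss κ z f) x θ₀ T)
      ≤ (1 / 2) ^ T * gap (surrogate κ z (risk f x)) θ₀ + p * E ^ 2 / (L₁ + κ) := by
  have hS := (hf.quadBounds hn hx).add_quadratic κ z
  obtain ⟨xs, hxs⟩ := hS.exists_min hm
    ((hf.continuous_risk hx).add (by fun_prop : Continuous fun θ : Param p => κ / 2 * ‖θ - z‖ ^ 2))
  rw [gap_eq hxs, gap_eq hxs]
  have hc : 0 ≤ p * E ^ 2 / (L₁ + κ) := by positivity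
  induction T with
  | zero => simpa [lpiGD] using hc
  | succ T ih =>
    rw [lpiGD]
    set θ := lpiGD Ker l (L₁ + κ) (fun _ => m) (fun _ => h) (surrogateLoss κ z f) x θ₀ T
    have h1 := hS.inexact_step hm hL hLm hxs θ _
      (sq_norm_approxGradient_sub_le (κ := κ) hf hn hE hw1 herr z θ)
    rw [add_sub_cancel] at h1
    refine h1.trans ?_
    have h2 : p * E ^ 2 / (2 * (L₁ + κ)) = p * E ^ 2 / (L₁ + κ) / 2 := by field_simp
    rw [h2, pow_succ (1 / 2 : ℝ) T]
    linarith

end Risk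

/-! ### Convergence of Catalyst -/

/-- The potential of the Catalyst iteration: the optimality gap of `θ` plus the weighted squared
distance of the auxiliary point `v` from the minimizer `xs`. -/
noncomputable def potential {p : ℕ} (μ : ℝ) (F : Param p → ℝ) (xs θ v : Param p) : ℝ :=
  F θ - F xs + μ / 2 * ‖v - xs‖ ^ 2

theorem sq_norm_smul_add_le {p : ℕ} {a : ℝ} (ha : 0 ≤ a) (P V : Param p) :
    ‖a • P + V‖ ^ 2 ≤ (1 + a) * (a * ‖P‖ ^ 2 + ‖V‖ ^ 2) := by
  have h1 := norm_add_sq_real (a • P) V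
  rw [norm_smul, mul_pow, Real.norm_eq_abs, sq_abs, real_inner_smul_left] at h1
  have h2 := norm_sub_sq_real P V
  nlinarith [mul_nonneg ha (sq_nonneg ‖P - V‖)]

/-- One outer iteration of Catalyst in the strongly convex regime, where `μ = L a ^ 2` and the
surrogate has curvature `κ = L - μ`. The cross term between the error of the inner loop and the
distance from the minimizer is split with weights `a / 6` and `6 / a`. -/
theorem QuadBounds.potential_step {p : ℕ} {μ L a ε : ℝ} {F : Param p → ℝ} {g : Param p → Param p}
    (hF : QuadBounds μ L F g) (hL : 0 < L) (ha : 0 < a) (ha1 : a < 1) (hμ : μ = L * a ^ 2)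
    {xs θp v z θ θs : Param p} (hxs : ∀ x, F xs ≤ F x) (hz : z = (1 / (1 + a)) • (θp + a • v))
    (hθs : ∀ x, surrogate (L - μ) z F θs ≤ surrogate (L - μ) z F x)
    (hε : surrogate (L - μ) z F θ - surrogate (L - μ) z F θs ≤ ε) :
    (1 - a / 6) * potential μ F xs θ (θp + (1 / a) • (θ - θp))
      ≤ (1 - a) * potential μ F xs θp v + (1 + 6 / a) * ε := by
  have ha1' : 0 < 1 + a := by linarith
  have hμL : μ < L := hμ ▸ mul_lt_of_lt_one_right hL (pow_lt_one₀ ha.le ha1 two_ne_zero)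
  have hS := hF.add_quadratic (L - μ) z
  rw [add_sub_cancel] at hS
  have hgr := hS.growth (by linarith) hθs
  -- the growth of the surrogate is tested at the point `w` between the minimizer and the old iterate
  set w := a • xs + (1 - a) • θp with hw
  set P := θp - xs with hP
  set V := v - xs with hV
  set V' := θp + (1 / a) • (θ - θp) - xs with hV'
  set D := θ - θs with hD
  have e1 : w - θs = D - a • V' := by
    have : a • ((1 / a) • (θ - θp)) = θ - θp := by
      rw [smul_smul, mul_one_div_cancel ha.ne', one_smul]
    rw [hD, hV', smul_sub, smul_add, this, hw]; module
  have e2 : w - z = (-(a / (1 + a))) • (a • P + V) := by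
    have h1 : w = (1 / (1 + a)) • ((1 + a) • w) := by
      rw [smul_smul, one_div_mul_cancel ha1'.ne', one_smul]
    have h2 : (-(a / (1 + a))) • (a • P + V) = (1 / (1 + a)) • (-(a • (a • P + V))) := by
      rw [smul_neg, smul_smul, neg_smul]; congr 2; ring
    rw [h2, h1, hz, ← smul_sub]
    congr 1
    rw [hw, hP, hV]; module
  have hgw := hgr w
  have hgθ := hgr θ
  rw [e1, norm_sub_sq_real, norm_smul, mul_pow, Real.norm_eq_abs, sq_abs, real_inner_smul_right]
    at hgw
  have hconv := hF.convex_combination ha.le ha1.le xs θp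
  rw [← hw, norm_sub_rev, ← hP] at hconv
  -- the curvature terms in `P` and `V` on the right are the ones absorbed by strong convexity of `F`
  -- and by the previous potential
  have hwz : (L - μ) / 2 * ‖w - z‖ ^ 2
      ≤ (1 - a) * (μ / 2) * (a * ‖P‖ ^ 2 + ‖V‖ ^ 2) := by
    rw [e2, norm_smul, mul_pow, Real.norm_eq_abs, sq_abs]
    have h1 := sq_norm_smul_add_le ha.le P V
    have hc : 0 ≤ (L - μ) / 2 * (-(a / (1 + a))) ^ 2 :=
      mul_nonneg (by linarith) (sq_nonneg _)
    calc _ = (L - μ) / 2 * (-(a / (1 + a))) ^ 2 * ‖a • P + V‖ ^ 2 := by ring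
      _ ≤ (L - μ) / 2 * (-(a / (1 + a))) ^ 2 * ((1 + a) * (a * ‖P‖ ^ 2 + ‖V‖ ^ 2)) := by gcongr
      _ = _ := by rw [hμ]; field_simp; ring
  -- weighted Young inequality; the weights match because `μ L = (L a) ^ 2`
  have hcross : L * a * inner ℝ D V' ≤ a / 6 * (μ / 2 * ‖V'‖ ^ 2) + 6 / a * (L / 2 * ‖D‖ ^ 2) := by
    have h1 := real_inner_le_norm D V'
    have h2 : L * a * inner ℝ D V' ≤ L * a * (‖D‖ * ‖V'‖) := by gcongr
    have h3 : a / 6 * (μ / 2 * ‖V'‖ ^ 2) + 6 / a * (L / 2 * ‖D‖ ^ 2) - L * a * (‖D‖ * ‖V'‖)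
        = L * a / 12 * (a * ‖V'‖ - 6 / a * ‖D‖) ^ 2 := by
      rw [hμ]; field_simp; ring
    have h4 : 0 ≤ L * a / 12 * (a * ‖V'‖ - 6 / a * ‖D‖) ^ 2 := by positivity
    linarith
  have hDε : 6 / a * (L / 2 * ‖D‖ ^ 2) ≤ 6 / a * ε := by
    gcongr; linarith
  have hFθ := hxs θ
  have hθz : F θ ≤ surrogate (L - μ) z F θ := by
    have : 0 ≤ (L - μ) / 2 * ‖θ - z‖ ^ 2 := mul_nonneg (by linarith) (sq_nonneg _)
    simp only [LPI.surrogate]; linarith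
  have hsw : surrogate (L - μ) z F w = F w + (L - μ) / 2 * ‖w - z‖ ^ 2 := rfl
  have hD0 : 0 ≤ L / 2 * ‖D‖ ^ 2 := by positivity
  have h7 : L / 2 * (‖D‖ ^ 2 - 2 * (a * inner ℝ D V') + a ^ 2 * ‖V'‖ ^ 2)
      = L / 2 * ‖D‖ ^ 2 - L * a * inner ℝ D V' + μ / 2 * ‖V'‖ ^ 2 := by rw [hμ]; ring
  rw [h7] at hgw
  have h8 : (1 - a / 6) * potential μ F xs θ (θp + (1 / a) • (θ - θp))
      ≤ F θ - F xs + (1 - a / 6) * (μ / 2 * ‖V'‖ ^ 2) := by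
    rw [potential, ← hV', mul_add]
    have : 0 ≤ a / 6 * (F θ - F xs) := mul_nonneg (by linarith) (by linarith)
    linarith
  have h9 : (1 - a) * potential μ F xs θp v
      = (1 - a) * (F θp - F xs) + (1 - a) * (μ / 2) * ‖V‖ ^ 2 := by rw [potential, ← hV]; ring
  rw [h9]
  refine h8.trans ?_
  linarith

/-- The previous iterate is a good starting point for the next surrogate. -/
theorem QuadBounds.gap_warm_start_le {p : ℕ} {μ L a : ℝ} {F : Param p → ℝ} {g : Param p → Param p}
    (hF : QuadBounds μ L F g) (hL : 0 < L) (ha : 0 < a) (ha1 : a < 1) (hμ : μ = L * a ^ 2)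
    {xs θ v z θs : Param p} (hxs : ∀ x, F xs ≤ F x) (hz : z = (1 / (1 + a)) • (θ + a • v))
    (hθs : ∀ x, surrogate (L - μ) z F θs ≤ surrogate (L - μ) z F x) :
    gap (surrogate (L - μ) z F) θ ≤ 5 * potential μ F xs θ v := by
  have hμL : μ < L := hμ ▸ mul_lt_of_lt_one_right hL (pow_lt_one₀ ha.le ha1 two_ne_zero)
  have hμ0 : 0 < μ := by rw [hμ]; positivity
  rw [gap_eq hθs]
  have h1 : F xs ≤ surrogate (L - μ) z F θs := by
    have : 0 ≤ (L - μ) / 2 * ‖θs - z‖ ^ 2 := mul_nonneg (by linarith) (sq_nonneg _)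
    have := hxs θs
    simp only [LPI.surrogate]; linarith
  have h2 : θ - z = (a / (1 + a)) • (θ - v) := by
    have h3 : θ - (1 / (1 + a)) • (θ + a • v)
        = (1 / (1 + a)) • ((1 + a) • θ - (θ + a • v)) := by
      rw [smul_sub, smul_smul, one_div_mul_cancel (by linarith), one_smul]
    have h4 : (a / (1 + a)) • (θ - v) = (1 / (1 + a)) • (a • (θ - v)) := by
      rw [smul_smul]; congr 1; ring
    rw [h4, hz, h3]
    congr 1; module
  have h3 : ‖θ - v‖ ^ 2 ≤ 2 * ‖θ - xs‖ ^ 2 + 2 * ‖v - xs‖ ^ 2 := by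
    have e : θ - v = (θ - xs) - (v - xs) := by abel
    have := parallelogram_law_with_norm ℝ (θ - xs) (v - xs)
    rw [e]
    nlinarith [sq_nonneg ‖(θ - xs) + (v - xs)‖]
  have h4 := hF.growth hL hxs θ
  have h5 : (L - μ) / 2 * ‖θ - z‖ ^ 2 ≤ μ / 2 * ‖θ - v‖ ^ 2 := by
    rw [h2, norm_smul, mul_pow, Real.norm_eq_abs, sq_abs, ← mul_assoc]
    gcongr
    have h6 : (L - μ) / 2 * (a / (1 + a)) ^ 2 = μ / 2 * ((1 - a) / (1 + a)) := by
      rw [hμ]; field_simp; ring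
    rw [h6]
    have h7 : (1 - a) / (1 + a) ≤ 1 := by rw [div_le_one (by linarith)]; linarith
    nlinarith
  have h6 : 0 ≤ μ / 2 * ‖v - xs‖ ^ 2 := by positivity
  have h7 : μ / 2 * ‖θ - v‖ ^ 2 ≤ μ / 2 * (2 * ‖θ - xs‖ ^ 2 + 2 * ‖v - xs‖ ^ 2) := by gcongr
  have h9 := hxs θ
  simp only [potential]
  have h8 : surrogate (L - μ) z F θ = F θ + (L - μ) / 2 * ‖θ - z‖ ^ 2 := rfl
  linarith

/-- One step of the induction that bounds the potential by `B / a ^ 2` times the geometric rate. -/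
theorem potential_bound_step {a B c R S S' ε : ℝ} (ha : 0 < a) (ha1 : a < 1) (hc : 0 ≤ c)
    (hB : 14 * c ≤ B) (hR : 0 ≤ R) (hS : S ≤ B / a ^ 2 * R)
    (hε : ε ≤ c * ((1 - a / 3) * R)) (h : (1 - a / 6) * S' ≤ (1 - a) * S + (1 + 6 / a) * ε) :
    S' ≤ B / a ^ 2 * ((1 - a / 3) * R) := by
  have h1 : (1 - a) * S ≤ (1 - a) * (B / a ^ 2 * R) := by gcongr
  have h2 : (1 + 6 / a) * ε ≤ (1 + 6 / a) * (c * R) := by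
    refine mul_le_mul_of_nonneg_left (hε.trans ?_) (by positivity)
    have : 0 ≤ c * R := mul_nonneg hc hR
    nlinarith
  have h3 : (1 - a) * (B / a ^ 2 * R) + (1 + 6 / a) * (c * R)
      ≤ (1 - a / 6) * (B / a ^ 2 * ((1 - a / 3) * R)) := by
    have e : (1 - a / 6) * (B / a ^ 2 * ((1 - a / 3) * R)) - ((1 - a) * (B / a ^ 2 * R)
        + (1 + 6 / a) * (c * R)) = (a * (B - 12 * c) + a ^ 2 * (B / 9 - 2 * c)) / 2 * (R / a ^ 2) := by
      field_simp; ring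
    have h4 : 0 ≤ (a * (B - 12 * c) + a ^ 2 * (B / 9 - 2 * c)) / 2 := by
      nlinarith [mul_nonneg ha.le (by linarith : (0:ℝ) ≤ B - 14 * c), mul_nonneg ha.le hc,
        mul_nonneg (sq_nonneg a) hc, mul_nonneg (mul_nonneg ha.le hc) (sub_nonneg.mpr ha1.le),
        mul_nonneg (sq_nonneg a) (by linarith : (0:ℝ) ≤ B - 14 * c)]
    have h5 : 0 ≤ R / a ^ 2 := by positivity
    nlinarith [mul_nonneg h4 h5]
  have h6 : (1 - a / 6) * S' ≤ (1 - a / 6) * (B / a ^ 2 * ((1 - a / 3) * R)) := by linarith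
  exact le_of_mul_le_mul_left h6 (by linarith)

/-- Convergence of Catalyst, provided that every inner loop started at an accuracy of order
`(1 - a / 3) ^ k Δ / a ^ 2` attains the accuracy `εs (k + 1)`. -/
theorem catalyst_convergence {d p n : ℕ} {Ker : ℝ → ℝ} {l : ℕ} {μ L a B c Δ : ℝ} {S : Schedule}
    {f : (Fin d → ℝ) → Param p → ℝ} {x : Fin n → Fin d → ℝ} {g : Param p → Param p} {εs : ℕ → ℝ}
    {K : ℕ} (hF : QuadBounds μ L (risk f x) g) (hcont : Continuous (risk f x)) (hL : 0 < L)
    (ha : 0 < a) (ha1 : a < 1) (hμ : μ = L * a ^ 2) (hc : 0 ≤ c) (hB : 14 * c ≤ B) (hB2 : 2 ≤ B)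
    (hΔ : 0 ≤ Δ) (hε : ∀ k, 1 ≤ k → εs k ≤ c * ((1 - a / 3) ^ k * Δ)) (θ₀ : Param p)
    (hgap : gap (risk f x) θ₀ = Δ)
    (hinner : ∀ k, k < K → ∀ z θ : Param p,
      gap (surrogate (L - μ) z (risk f x)) θ ≤ 5 * (B / a ^ 2 * ((1 - a / 3) ^ k * Δ)) →
      gap (surrogate (L - μ) z (risk f x)) (lpiGD Ker l (L + (L - μ)) (S.m (k + 1)) (S.h (k + 1))
        (surrogateLoss (L - μ) z f) x θ (S.T (k + 1))) ≤ εs (k + 1)) :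
    (∀ k ∈ Finset.Icc 1 K, gap (surrogate (L - μ) (catalyst Ker l μ L S f x θ₀ (k - 1)).z (risk f x))
        (catalyst Ker l μ L S f x θ₀ k).θ ≤ εs k) ∧
      gap (risk f x) (catalyst Ker l μ L S f x θ₀ K).θ ≤ B / a ^ 2 * ((1 - a / 3) ^ K * Δ) := by
  have hμ0 : 0 < μ := by rw [hμ]; positivity
  have hμL : μ < L := hμ ▸ mul_lt_of_lt_one_right hL (pow_lt_one₀ ha.le ha1 two_ne_zero)
  have hq : μ / (μ + (L - μ)) = a ^ 2 := by rw [add_sub_cancel, hμ]; field_simp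
  have hα : nextAlpha (a ^ 2) a = a :=
    ((nextAlpha_iff (by nlinarith) ha a).mp ⟨⟨ha, ha1⟩, by ring⟩).symm
  obtain ⟨xs, hxs⟩ := hF.exists_min hμ0 hcont
  have hmin : ∀ z, ∃ θs, ∀ y, surrogate (L - μ) z (risk f x) θs ≤ surrogate (L - μ) z (risk f x) y :=
    fun z => (hF.add_quadratic (L - μ) z).exists_min (by linarith)
      (hcont.add (by fun_prop : Continuous fun θ : Param p => (L - μ) / 2 * ‖θ - z‖ ^ 2))
  have hr0 : 0 ≤ 1 - a / 3 := by linarith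
  have hstep : ∀ k, k < K → ∀ v, (catalyst Ker l μ L S f x θ₀ k).z
        = (1 / (1 + a)) • ((catalyst Ker l μ L S f x θ₀ k).θ + a • v) →
      potential μ (risk f x) xs (catalyst Ker l μ L S f x θ₀ k).θ v
        ≤ B / a ^ 2 * ((1 - a / 3) ^ k * Δ) →
      gap (surrogate (L - μ) (catalyst Ker l μ L S f x θ₀ k).z (risk f x))
        (catalyst Ker l μ L S f x θ₀ (k + 1)).θ ≤ εs (k + 1) := by
    intro k hk v hz hpot
    obtain ⟨θs, hθs⟩ := hmin (catalyst Ker l μ L S f x θ₀ k).z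
    exact hinner k hk _ _ ((hF.gap_warm_start_le hL ha ha1 hμ hxs hz hθs).trans (by linarith))
  have hinv : ∀ k, k ≤ K → (catalyst Ker l μ L S f x θ₀ k).α = a ∧
      ∃ v, (catalyst Ker l μ L S f x θ₀ k).z
        = (1 / (1 + a)) • ((catalyst Ker l μ L S f x θ₀ k).θ + a • v) ∧
      potential μ (risk f x) xs (catalyst Ker l μ L S f x θ₀ k).θ v
        ≤ B / a ^ 2 * ((1 - a / 3) ^ k * Δ) := by
    intro k
    induction k with
    | zero =>
      intro _
      -- at the start `v = θ`, and the potential is at most twice the initial gap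
      refine ⟨?_, θ₀, ?_, ?_⟩
      · simp only [catalyst]
        rw [hq, Real.sqrt_sq ha.le]
      · simp only [catalyst]
        have : θ₀ + a • θ₀ = (1 + a) • θ₀ := by module
        rw [this, smul_smul, one_div_mul_cancel (by linarith), one_smul]
      · simp only [catalyst, potential, pow_zero, one_mul]
        have h1 := hF.growth hL hxs θ₀
        rw [gap_eq hxs] at hgap
        have h2 : 2 ≤ B / a ^ 2 := by
          rw [le_div_iff₀ (by positivity)]; nlinarith
        nlinarith
    | succ k ih =>
      intro hk
      obtain ⟨hαk, v, hz, hpot⟩ := ih (by omega)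
      have hg := hstep k (by omega) v hz hpot
      obtain ⟨θs, hθs⟩ := hmin (catalyst Ker l μ L S f x θ₀ k).z
      rw [gap_eq hθs] at hg
      have hps := hF.potential_step hL ha ha1 hμ hxs hz hθs hg
      refine ⟨?_, (catalyst Ker l μ L S f x θ₀ k).θ + (1 / a) •
          ((catalyst Ker l μ L S f x θ₀ (k + 1)).θ - (catalyst Ker l μ L S f x θ₀ k).θ), ?_, ?_⟩
      · simp only [catalyst]
        rw [hαk, hq, hα]
      · have hzz : (catalyst Ker l μ L S f x θ₀ (k + 1)).z
            = (catalyst Ker l μ L S f x θ₀ (k + 1)).θ + (a * (1 - a) / (a ^ 2 + a)) •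
              ((catalyst Ker l μ L S f x θ₀ (k + 1)).θ - (catalyst Ker l μ L S f x θ₀ k).θ) := by
          simp only [catalyst]
          rw [hαk, hq, hα]
        rw [hzz]
        set t := (catalyst Ker l μ L S f x θ₀ (k + 1)).θ
        set s := (catalyst Ker l μ L S f x θ₀ k).θ
        have h1 : a • (s + (1 / a) • (t - s)) = a • s + (t - s) := by
          rw [smul_add, smul_smul, mul_one_div_cancel ha.ne', one_smul]
        have h2 : a * (1 - a) / (a ^ 2 + a) = (1 / (1 + a)) * (1 - a) := by field_simp; ring
        have h3 : t + (1 / (1 + a)) • ((1 - a) • (t - s))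
            = (1 / (1 + a)) • ((1 + a) • t + (1 - a) • (t - s)) := by
          rw [smul_add, smul_smul _ (1 + a), one_div_mul_cancel (by linarith), one_smul]
        rw [h1, h2, ← smul_smul, h3]
        congr 1; module
      · have := hε (k + 1) (by omega)
        rw [pow_succ' (1 - a / 3), mul_assoc] at this ⊢
        exact potential_bound_step ha ha1 hc hB (by positivity) hpot this hps
  constructor
  · intro k hk
    obtain ⟨h1, h2⟩ := Finset.mem_Icc.mp hk
    obtain ⟨j, rfl⟩ : ∃ j, k = j + 1 := ⟨k - 1, by omega⟩
    obtain ⟨-, v, hz, hpot⟩ := hinv j (by omega)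
    exact hstep j (by omega) v hz hpot
  · obtain ⟨-, v, -, hpot⟩ := hinv K le_rfl
    rw [gap_eq hxs]
    rw [potential] at hpot
    have : 0 ≤ μ / 2 * ‖v - xs‖ ^ 2 := by positivity
    linarith

/-! ### Choice of the parameters -/

theorem card_grid_le (d m : ℕ) : (grid d m).card ≤ m ^ d :=
  Finset.card_image_le.trans (by simp)

/-- The number of outer iterations: the accuracy `(1 - a / 3) ^ K` is `a ^ 2 ε / (B Δ)` up to a
factor between `2 / 3` and `1`. -/
theorem exists_outer_count {a B Δ ε : ℝ} (ha : 0 < a) (ha1 : a < 1) (hB : 2 ≤ B) (hε : 0 < ε)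
    (hεΔ : ε ≤ Δ / 2) :
    ∃ K : ℕ, 1 ≤ K ∧ B / a ^ 2 * ((1 - a / 3) ^ K * Δ) ≤ ε ∧
      2 / 3 * ε ≤ B / a ^ 2 * ((1 - a / 3) ^ K * Δ) ∧
      (K : ℝ) ≤ 1 + 3 / a * Real.log (B * (Δ / (a ^ 2 * ε))) := by
  have hΔ : 0 < Δ := by linarith
  set r := 1 - a / 3 with hr
  have hr0 : 0 < r := by rw [hr]; linarith
  have hr1 : r < 1 := by rw [hr]; linarith
  set Y := B * (Δ / (a ^ 2 * ε)) with hY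
  have hY1 : 1 < Y := by
    have h1 : 2 ≤ Δ / (a ^ 2 * ε) := by
      rw [le_div_iff₀ (by positivity)]; nlinarith [mul_pos ha hε]
    nlinarith
  have hlog : 0 < Real.log Y := Real.log_pos hY1
  have hlr : a / 3 ≤ -Real.log r := by
    have := Real.log_le_sub_one_of_pos hr0
    rw [hr] at this ⊢; linarith
  have hlr0 : 0 < -Real.log r := by linarith
  set t := Real.log Y / (-Real.log r) with ht
  have ht0 : 0 < t := div_pos hlog hlr0
  have htlr : t * (-Real.log r) = Real.log Y := div_mul_cancel₀ _ hlr0.ne'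
  have hc1 := Nat.le_ceil t
  have hc2 := Nat.ceil_lt_add_one ht0.le
  have hexp : r ^ ⌈t⌉₊ = Real.exp (⌈t⌉₊ * Real.log r) := by
    rw [Real.exp_nat_mul, Real.exp_log hr0]
  have hYe : Y⁻¹ = Real.exp (-Real.log Y) := by
    rw [Real.exp_neg, Real.exp_log (by linarith)]
  have hup : r ^ ⌈t⌉₊ ≤ Y⁻¹ := by
    rw [hexp, hYe]; apply Real.exp_le_exp.mpr; nlinarith
  have hlow : r * Y⁻¹ ≤ r ^ ⌈t⌉₊ := by
    rw [hexp, hYe]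
    nth_rewrite 1 [← Real.exp_log hr0]
    rw [← Real.exp_add]; apply Real.exp_le_exp.mpr; nlinarith
  have hid : B / a ^ 2 * (Y⁻¹ * Δ) = ε := by rw [hY]; field_simp
  refine ⟨⌈t⌉₊, Nat.one_le_ceil_iff.mpr ht0, ?_, ?_, ?_⟩
  · calc _ ≤ B / a ^ 2 * (Y⁻¹ * Δ) := by gcongr
      _ = ε := hid
  · calc 2 / 3 * ε ≤ r * ε := by gcongr; rw [hr]; linarith
      _ = B / a ^ 2 * (r * Y⁻¹ * Δ) := by rw [← hid]; ring
      _ ≤ _ := by gcongr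
  · have : t ≤ 3 / a * Real.log Y := by
      rw [ht, div_le_iff₀ hlr0]
      have h1 : 3 / a * Real.log Y * (a / 3) = Real.log Y := by field_simp
      have h2 : 3 / a * Real.log Y * (a / 3) ≤ 3 / a * Real.log Y * -Real.log r := by gcongr
      linarith
    linarith

/-- `T` halvings reduce a factor `D / q` to one, and `T` is bounded by a multiple of `log Z`, since
`log Z` dominates both `log 2` and `2 log (1 / q)`. -/
theorem exists_inner_count {q D Z : ℝ} (hq : 0 < q) (hq1 : q < 1) (hD : 1 ≤ D) (hZ2 : 2 ≤ Z)
    (hZq : 1 / q ^ 2 ≤ Z) :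
    ∃ T : ℕ, (1 / 2 : ℝ) ^ T * (D / q) ≤ 1 ∧
      (T : ℝ) ≤ ((1 + Real.log D / Real.log 2) / Real.log 2 + 1 / (2 * Real.log 2)) * Real.log Z := by
  have hl2 : 0 < Real.log 2 := Real.log_pos (by norm_num)
  have hDq : 1 ≤ D / q := by rw [le_div_iff₀ hq]; linarith
  have ht0 : 0 ≤ Real.log (D / q) / Real.log 2 := div_nonneg (Real.log_nonneg hDq) hl2.le
  have hc1 := Nat.le_ceil (Real.log (D / q) / Real.log 2)
  have hc2 := Nat.ceil_lt_add_one ht0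
  refine ⟨⌈Real.log (D / q) / Real.log 2⌉₊, ?_, ?_⟩
  · rw [one_div, inv_pow, inv_mul_le_iff₀ (by positivity), mul_one]
    rw [div_le_iff₀ hl2, ← Real.log_pow] at hc1
    exact (Real.log_le_log_iff (by positivity) (by positivity)).mp hc1
  · have hZl : Real.log 2 ≤ Real.log Z := Real.log_le_log (by norm_num) hZ2
    have hZl2 : 2 * -Real.log q ≤ Real.log Z := by
      have h1 := Real.log_le_log (by positivity) hZq
      rw [one_div, Real.log_inv, Real.log_pow] at h1
      push_cast at h1; linarith
    have hlD : 0 ≤ Real.log D := Real.log_nonneg hD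
    rw [Real.log_div (by positivity) hq.ne'] at hc2 ⊢
    refine hc2.le.trans ?_
    have e : (Real.log D - Real.log q) / Real.log 2 + 1
        = (1 + Real.log D / Real.log 2) + -Real.log q / Real.log 2 := by ring
    rw [e, add_mul]
    gcongr
    · rw [div_mul_eq_mul_div, le_div_iff₀ hl2]; gcongr
    · rw [div_mul_eq_mul_div, one_mul, div_le_div_iff₀ hl2 (by positivity)]
      nlinarith

/-- The grid parameter: with `X` the reciprocal of the admissible squared error, `m ^ η` has to be of
order `√X`. -/
theorem exists_grid_parameter {η X₀ H W ρ τ : ℝ} (hη : 0 < η) (hX₀ : 0 < X₀) (hH : 0 < H)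
    (hW : 0 < W) (hρ : 0 < ρ) (hτ : 0 < τ) :
    ∃ C : ℝ, 0 < C ∧ ∀ X, X₀ ≤ X → ∃ m : ℕ, 0 < m ∧ H / m ≤ ρ ∧
      (m : ℝ) ≤ C * X ^ (1 / (2 * η)) ∧ (W * (H / m) ^ η) ^ 2 ≤ τ / X := by
  set c₁ := max (max 1 (H / ρ) / X₀ ^ (1 / (2 * η))) ((W ^ 2 / τ) ^ (1 / (2 * η)) * H) with hc₁
  have hX₀p : 0 < X₀ ^ (1 / (2 * η)) := by positivity
  have hc₁p : 0 < c₁ := lt_max_of_lt_right (by positivity)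
  refine ⟨2 * c₁, by positivity, fun X hX => ?_⟩
  have hXp : 0 < X := hX₀.trans_le hX
  have hXe : 0 < X ^ (1 / (2 * η)) := by positivity
  have hbase : max 1 (H / ρ) ≤ c₁ * X ^ (1 / (2 * η)) := by
    calc max 1 (H / ρ) = max 1 (H / ρ) / X₀ ^ (1 / (2 * η)) * X₀ ^ (1 / (2 * η)) := by
          field_simp
      _ ≤ c₁ * X ^ (1 / (2 * η)) := by
          gcongr
          exact le_max_left _ _
  have h1 : 1 ≤ c₁ * X ^ (1 / (2 * η)) := (le_max_left _ _).trans hbase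
  have h2 : H / ρ ≤ c₁ * X ^ (1 / (2 * η)) := (le_max_right _ _).trans hbase
  have hm1 := Nat.le_ceil (c₁ * X ^ (1 / (2 * η)))
  have hm2 := Nat.ceil_lt_add_one (by positivity : 0 ≤ c₁ * X ^ (1 / (2 * η)))
  set m := ⌈c₁ * X ^ (1 / (2 * η))⌉₊ with hm
  have hmp : (0 : ℝ) < m := by linarith
  refine ⟨m, by exact_mod_cast hmp, ?_, by linarith, ?_⟩
  · rw [div_le_iff₀ hmp]
    rw [div_le_iff₀ hρ] at h2
    nlinarith
  · have h3 : (W ^ 2 / τ * X) ^ (1 / (2 * η)) * H ≤ m := by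
      rw [Real.mul_rpow (by positivity) hXp.le]
      calc _ = (W ^ 2 / τ) ^ (1 / (2 * η)) * H * X ^ (1 / (2 * η)) := by ring
        _ ≤ c₁ * X ^ (1 / (2 * η)) := by gcongr; exact le_max_right _ _
        _ ≤ m := hm1
    have h4 : (W ^ 2 / τ * X) ^ (1 / (2 * η)) ≤ m / H := by rwa [le_div_iff₀ hH]
    have h5 := Real.rpow_le_rpow (by positivity) h4 (by positivity : 0 ≤ 2 * η)
    rw [← Real.rpow_mul (by positivity), one_div_mul_cancel (by positivity), Real.rpow_one,
      mul_comm 2 η, Real.rpow_mul (by positivity), Real.rpow_two] at h5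
    have h6 : (H / m) ^ η = ((m / H) ^ η)⁻¹ := by
      rw [← Real.inv_rpow (by positivity), inv_div]
    have h7 : 0 < (m / H) ^ η := by positivity
    rw [h6, mul_pow, inv_pow, ← div_eq_mul_inv, div_le_div_iff₀ (by positivity) hXp]
    calc W ^ 2 * X = τ * (W ^ 2 / τ * X) := by field_simp
      _ ≤ _ := by gcongr

/-- The iteration bound in terms of either of the two logarithms. If `ε ≤ Δ / (2 σ ^ 2)`, then
`σ ≤ Δ / (σ ε)`, so that the larger logarithm is at most three times the smaller one. -/
theorem outer_count_le {K σ Δ ε B Λ : ℝ} (hσ : 1 < σ) (hε : 0 < ε) (hεΔ : ε ≤ Δ / 2)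
    (hB : 2 ≤ B) (hK : K ≤ 1 + 3 * Real.sqrt σ * Real.log (B * (σ * Δ / ε)))
    (hΛ : Λ = Real.log (σ * Δ / ε) ∨ (ε ≤ Δ / (2 * σ ^ 2) ∧ Λ = Real.log (Δ / (σ * ε)))) :
    0 ≤ Λ ∧ K ≤ 3 * ((1 + 3 * Real.log B) / Real.log 2 + 3) * (Real.sqrt σ * Λ) := by
  have hΔ : 0 < Δ := by linarith
  have hl2 : 0 < Real.log 2 := Real.log_pos (by norm_num)
  have hlB : 0 ≤ Real.log B := Real.log_nonneg (by linarith)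
  have hs : 1 ≤ Real.sqrt σ := Real.one_le_sqrt.mpr hσ.le
  have h2 : 2 ≤ σ * Δ / ε := by rw [le_div_iff₀ hε]; nlinarith
  set Λ₁ := Real.log (σ * Δ / ε) with hΛ₁
  have h3 : Real.log 2 ≤ Λ₁ := Real.log_le_log (by norm_num) h2
  have hle : Λ₁ ≤ 3 * Λ := by
    rcases hΛ with rfl | ⟨hsmall, rfl⟩
    · linarith
    · have h4 : σ ≤ Δ / (σ * ε) := by
        rw [le_div_iff₀ (by positivity)] at hsmall ⊢
        nlinarith [mul_pos hε (by positivity : 0 < σ ^ 2)]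
      have h5 := Real.log_le_log (by linarith) h4
      have h6 : Λ₁ = Real.log (Δ / (σ * ε)) + 2 * Real.log σ := by
        have : σ * Δ / ε = Δ / (σ * ε) * σ ^ 2 := by field_simp
        rw [hΛ₁, this, Real.log_mul (by positivity) (by positivity), Real.log_pow]
        push_cast; ring
      linarith
  refine ⟨by linarith, hK.trans ?_⟩
  rw [Real.log_mul (by linarith) (by linarith), ← hΛ₁]
  have h7 : 1 + 3 * Real.log B ≤ (1 + 3 * Real.log B) / Real.log 2 * Λ₁ := by
    rw [div_mul_eq_mul_div, le_div_iff₀ hl2]; gcongr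
  have hc : 0 ≤ (1 + 3 * Real.log B) / Real.log 2 + 3 := by positivity
  calc 1 + 3 * Real.sqrt σ * (Real.log B + Λ₁)
      ≤ Real.sqrt σ * (1 + 3 * Real.log B + 3 * Λ₁) := by linarith
    _ ≤ Real.sqrt σ * ((1 + 3 * Real.log B) / Real.log 2 * Λ₁ + 3 * Λ₁) := by gcongr
    _ = ((1 + 3 * Real.log B) / Real.log 2 + 3) * (Real.sqrt σ * Λ₁) := by ring
    _ ≤ ((1 + 3 * Real.log B) / Real.log 2 + 3) * (Real.sqrt σ * (3 * Λ)) := by gcongr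
    _ = _ := by ring

/-- With constant parameters, the oracle calls are counted by the number of outer iterations, the
length of the inner loops and the size of the grid. -/
theorem oracleCalls_le {d K T m : ℕ} {h A A₁ A₂ Y Z X : ℝ} (hA₁ : 0 ≤ A₁) (hA : A₁ * A₂ ≤ A)
    (hY : 0 ≤ Y) (hZ : 0 ≤ Z) (hK : K ≤ A₁ * Y) (hT : T ≤ A₂ * Z) (hm : (m : ℝ) ^ d ≤ X) :
    (oracleCalls d K ⟨fun _ => T, fun _ _ => m, fun _ _ => h⟩ : ℝ) ≤ A * (Y * X * Z) := by
  have h1 : oracleCalls d K ⟨fun _ => T, fun _ _ => m, fun _ _ => h⟩ ≤ K * (T * m ^ d) := by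
    simp only [oracleCalls, Finset.sum_const, Nat.card_Icc, Finset.card_range, smul_eq_mul,
      add_tsub_cancel_right]
    gcongr
    exact card_grid_le d m
  have hX : 0 ≤ X := le_trans (by positivity) hm
  have hT0 : 0 ≤ A₂ * Z := (Nat.cast_nonneg T).trans hT
  calc (oracleCalls d K ⟨fun _ => T, fun _ _ => m, fun _ _ => h⟩ : ℝ)
      ≤ K * (T * (m : ℝ) ^ d) := by exact_mod_cast h1
    _ ≤ (A₁ * Y) * ((A₂ * Z) * X) := by gcongr
    _ = A₁ * A₂ * (Y * X * Z) := by ring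
    _ ≤ _ := by gcongr

/-- The stationary error of the inner loops when the squared gradient error is `E ^ 2` per
coordinate and the last inner accuracy is `e`. -/
theorem stationary_error_le {c₁ c₂ L L' P E X e R : ℝ} (hc₁ : 0 < c₁) (hc₂ : 0 < c₂) (hL : 0 < L)
    (hLL : L ≤ L') (hP : 0 < P) (he : 0 < e) (hX : P / e ≤ X)
    (hE : E ^ 2 ≤ c₁ * L / (2 * c₂) / X) (heR : e ≤ c₂ * R) :
    P * E ^ 2 / L' ≤ c₁ * R / 2 := by
  have h1 : E ^ 2 ≤ c₁ * L / (2 * c₂) / (P / e) := hE.trans (by gcongr)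
  calc P * E ^ 2 / L' ≤ P * (c₁ * L / (2 * c₂) / (P / e)) / L := by gcongr
    _ = c₁ / (2 * c₂) * e := by field_simp
    _ ≤ c₁ / (2 * c₂) * (c₂ * R) := by gcongr
    _ = c₁ * R / 2 := by field_simp

/-- The contribution of the starting point to the final error of an inner loop. -/
theorem initial_error_le {T k : ℕ} {B D c q r Δ G : ℝ} (hc : 0 < c) (hD : D = 15 * B / c)
    (hr : 2 / 3 ≤ r) (hΔ : 0 ≤ Δ) (hT : (1 / 2 : ℝ) ^ T * (D / q) ≤ 1)
    (hG : G ≤ 5 * (B / q * (r ^ k * Δ))) :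
    (1 / 2 : ℝ) ^ T * G ≤ c * (r ^ (k + 1) * Δ) / 2 := by
  have hr0 : 0 ≤ r := by linarith
  calc (1 / 2 : ℝ) ^ T * G ≤ (1 / 2 : ℝ) ^ T * (5 * (B / q * (r ^ k * Δ))) := by gcongr
    _ = (1 / 2 : ℝ) ^ T * (D / q) * (c / 3 * (r ^ k * Δ)) := by
      rw [hD]; field_simp; ring
    _ ≤ 1 * (c / 3 * (r ^ k * Δ)) := by gcongr
    _ = c * (r ^ k * (2 / 3) * Δ) / 2 := by ring
    _ ≤ c * (r ^ (k + 1) * Δ) / 2 := by rw [pow_succ]; gcongr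

end LPI

theorem theorem1 (c₁ c₂ : ℝ) (hc₁ : 0 < c₁) (hc₂ : c₁ ≤ c₂) :
    ∃ A : ℝ, 0 < A ∧
    ∀ (d : ℕ) (η L₁ L₂ ρ : ℝ) (Ker : ℝ → ℝ),
      0 < d → 0 < η → 0 < L₁ → 0 < L₂ → 0 < ρ → LPI.IsKernel Ker →
    ∃ C : ℝ, 0 < C ∧
    ∀ (μ σ q : ℝ) (p : ℕ) (Δ ε : ℝ) (εs : ℕ → ℝ),
      0 < μ → μ < L₁ → σ = L₁ / μ → q = 1 / σ → 0 < p →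
      -- the inner accuracies are of order `(1 - 1/(3√σ))^k (F(θ₀) - F*)`
      (∀ k, 1 ≤ k → c₁ * ((1 - 1 / (3 * Real.sqrt σ)) ^ k * Δ) ≤ εs k ∧
        εs k ≤ c₂ * ((1 - 1 / (3 * Real.sqrt σ)) ^ k * Δ)) →
      -- the target accuracy
      0 < ε → ε ≤ Δ / 2 → 2 ≤ 1 / q ^ 2 + p / (2 * L₁) / ε →
    ∃ (K M : ℕ) (S : LPI.Schedule),
      1 ≤ K ∧
      (∀ k t, 0 < S.h k t ∧ S.h k t ≤ ρ ∧ 0 < S.m k t ∧ S.m k t ≤ M) ∧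
      -- size of the grids, length of the inner loops, and the last inner accuracy
      (M : ℝ) ^ d ≤ C * (p / εs K + 2 * L₁ / q ^ 2) ^ ((d : ℝ) / (2 * η)) ∧
      (∀ k, (S.T k : ℝ) ≤ A * Real.log (1 / q ^ 2 + p / (2 * L₁) / εs K)) ∧
      ε ≤ A * (εs K / q) ∧
      -- number of outer iterations and total number of oracle calls
      (∀ Λ : ℝ,
        (Λ = Real.log (σ * Δ / ε) ∨ (ε ≤ Δ / (2 * σ ^ 2) ∧ Λ = Real.log (Δ / (σ * ε)))) →
        (K : ℝ) ≤ A * (Real.sqrt σ * Λ) ∧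
        (LPI.oracleCalls d K S : ℝ) ≤ A * (Real.sqrt σ * (M : ℝ) ^ d * Λ *
          Real.log (1 / q ^ 2 + p / (2 * L₁) / εs K)) ∧
        (LPI.oracleCalls d K S : ℝ) ≤ A * (Real.sqrt σ * Λ * C *
          (p / εs K + 2 * L₁ / q ^ 2) ^ ((d : ℝ) / (2 * η)) *
          Real.log (1 / q ^ 2 + p / (2 * L₁) / εs K))) ∧
      -- with these parameters the algorithm reaches the accuracy `ε` on every problem
      ∀ (n : ℕ) (f : (Fin d → ℝ) → LPI.Param p → ℝ) (x : Fin n → Fin d → ℝ) (θ₀ : LPI.Param p),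
        0 < n → LPI.LossAssumptions μ L₁ L₂ η f →
        (∀ j i, x j i ∈ Set.Icc ρ (1 - ρ)) →
        LPI.gap (LPI.risk f x) θ₀ = Δ →
        (∀ k ∈ Finset.Icc 1 K,
          LPI.gap
            (LPI.surrogate (L₁ - μ) (LPI.catalyst Ker (LPI.order η) μ L₁ S f x θ₀ (k - 1)).z
              (LPI.risk f x))
            (LPI.catalyst Ker (LPI.order η) μ L₁ S f x θ₀ k).θ ≤ εs k) ∧
        LPI.gap (LPI.risk f x) (LPI.catalyst Ker (LPI.order η) μ L₁ S f x θ₀ K).θ ≤ ε := by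
  have hc₂0 : 0 < c₂ := hc₁.trans_le hc₂
  have hl2 : 0 < Real.log 2 := Real.log_pos (by norm_num)
  -- `14 c₂` is needed to propagate the bound on the potential, `2` to start it
  obtain ⟨B, hB⟩ : ∃ B : ℝ, B = 14 * c₂ + 2 := ⟨_, rfl⟩
  have hB2 : 2 ≤ B := by linarith
  -- the initial inner error `5 (B / q) (1 - a / 3) ^ k Δ` has to drop below half of
  -- `c₁ (1 - a / 3) ^ (k + 1) Δ`, and `1 - a / 3 ≥ 2 / 3`
  obtain ⟨D, hD⟩ : ∃ D : ℝ, D = 15 * B / c₁ := ⟨_, rfl⟩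
  have hD1 : 1 ≤ D := by rw [hD, le_div_iff₀ hc₁]; linarith
  have hlB : 0 ≤ Real.log B := Real.log_nonneg (by linarith)
  have hlD : 0 ≤ Real.log D := Real.log_nonneg hD1
  obtain ⟨A₁, hA₁⟩ : ∃ A₁ : ℝ, A₁ = 3 * ((1 + 3 * Real.log B) / Real.log 2 + 3) := ⟨_, rfl⟩
  obtain ⟨A₂, hA₂⟩ : ∃ A₂ : ℝ,
    A₂ = (1 + Real.log D / Real.log 2) / Real.log 2 + 1 / (2 * Real.log 2) := ⟨_, rfl⟩
  obtain ⟨A₃, hA₃⟩ : ∃ A₃ : ℝ, A₃ = 3 * B / (2 * c₁) := ⟨_, rfl⟩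
  have hA₁0 : 0 < A₁ := by rw [hA₁]; positivity
  have hA₂0 : 0 < A₂ := by rw [hA₂]; positivity
  have hA₃0 : 0 < A₃ := by rw [hA₃]; positivity
  have hA₁₂ : 0 < A₁ * A₂ := mul_pos hA₁0 hA₂0
  refine ⟨A₁ + A₂ + A₃ + A₁ * A₂, by positivity, ?_⟩
  intro d η L₁ L₂ ρ Ker _hd hη hL₁ hL₂ hρ hKer
  obtain ⟨H, W, hH, hW, hint⟩ := LPI.exists_interpolation_constants d hη hL₂ hKer
  -- the squared gradient error may be as large as a multiple of `L₁` times the smallest inner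
  -- accuracy; the ratio `c₁ / c₂` accounts for `εs` not being monotone
  obtain ⟨C, hC, hgrid⟩ := LPI.exists_grid_parameter (τ := c₁ * L₁ / (2 * c₂)) hη
    (by positivity : 0 < 2 * L₁) hH hW hρ (by positivity)
  refine ⟨C ^ d, by positivity, ?_⟩
  intro μ σ q p Δ ε εs hμ hμL hσ hq hp hεs hε hεΔ h2
  have hΔ : 0 < Δ := by linarith
  have hσ1 : 1 < σ := by rw [hσ, one_lt_div hμ]; exact hμL
  have hσ0 : 0 < σ := by linarith
  have hs1 : 1 < Real.sqrt σ := by rw [Real.lt_sqrt zero_le_one]; linarith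
  have hs0 : 0 < Real.sqrt σ := by linarith
  obtain ⟨a, haσ⟩ : ∃ a : ℝ, a = 1 / Real.sqrt σ := ⟨_, rfl⟩
  have ha : 0 < a := by rw [haσ]; positivity
  have ha1 : a < 1 := by rw [haσ, div_lt_one hs0]; exact hs1
  have haq : a ^ 2 = q := by rw [haσ, div_pow, Real.sq_sqrt hσ0.le, hq, one_pow]
  have hμa : μ = L₁ * a ^ 2 := by rw [haq, hq, hσ]; field_simp
  have hq0 : 0 < q := haq ▸ by positivity
  have hq1 : q < 1 := haq ▸ pow_lt_one₀ ha.le ha1 two_ne_zero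
  have hrate : 1 - 1 / (3 * Real.sqrt σ) = 1 - a / 3 := by rw [haσ]; field_simp
  rw [hrate] at hεs
  obtain ⟨K, hK1, hKup, hKlow, hKle⟩ := LPI.exists_outer_count ha ha1 hB2 hε hεΔ
  obtain ⟨r, hr⟩ : ∃ r : ℝ, r = 1 - a / 3 := ⟨_, rfl⟩
  rw [← hr] at hεs hKup hKlow
  have hr23 : 2 / 3 ≤ r := by rw [hr]; linarith
  have hr0 : 0 < r := by linarith
  have hr1 : r ≤ 1 := by rw [hr]; linarith
  obtain ⟨hεK1, hεK2⟩ := hεs K hK1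
  have hεK0 : 0 < εs K := lt_of_lt_of_le (by positivity) hεK1
  have hεKε : εs K ≤ ε := by
    refine (hεK2.trans ?_).trans hKup
    gcongr
    rw [le_div_iff₀ (by positivity), haq]
    exact (mul_le_of_le_one_right hc₂0.le hq1.le).trans (by linarith)
  have hZ2 : 2 ≤ 1 / q ^ 2 + p / (2 * L₁) / εs K := by
    refine h2.trans ?_
    gcongr
  obtain ⟨Z, hZ⟩ : ∃ Z : ℝ, Z = 1 / q ^ 2 + p / (2 * L₁) / εs K := ⟨_, rfl⟩
  obtain ⟨X, hX⟩ : ∃ X : ℝ, X = p / εs K + 2 * L₁ / q ^ 2 := ⟨_, rfl⟩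
  have hp0 : (0 : ℝ) < p := by exact_mod_cast hp
  have hX0 : 2 * L₁ ≤ X := by
    have h3 : 2 * L₁ ≤ 2 * L₁ / q ^ 2 := by
      rw [le_div_iff₀ (by positivity)]
      exact mul_le_of_le_one_right (by positivity) (pow_le_one₀ hq0.le hq1.le)
    rw [hX]
    linarith [div_pos hp0 hεK0]
  have hXp : 0 < X := by linarith
  have hXe : p / εs K ≤ X := by
    rw [hX]; exact le_add_of_nonneg_right (by positivity)
  obtain ⟨m, hm, hmρ, hmC, hmE⟩ := hgrid X hX0
  have hm0 : (0 : ℝ) < m := by exact_mod_cast hm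
  have hZq : 1 / q ^ 2 ≤ Z := by
    rw [hZ]; linarith [div_pos (div_pos hp0 (by positivity : 0 < 2 * L₁)) hεK0]
  rw [← hZ] at hZ2
  obtain ⟨T, hT1, hT2⟩ := LPI.exists_inner_count hq0 hq1 hD1 hZ2 hZq
  rw [← hA₂] at hT2
  have hlZ : 0 ≤ Real.log Z := Real.log_nonneg (by linarith)
  have hMd : (m : ℝ) ^ d ≤ C ^ d * X ^ ((d : ℝ) / (2 * η)) := by
    calc (m : ℝ) ^ d ≤ (C * X ^ (1 / (2 * η))) ^ d := by gcongr
      _ = C ^ d * X ^ ((d : ℝ) / (2 * η)) := by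
        rw [mul_pow, ← Real.rpow_natCast (X ^ (1 / (2 * η))), ← Real.rpow_mul hXp.le]
        congr 2; ring
  have hHm : 0 < H / m := by positivity
  refine ⟨K, m, ⟨fun _ => T, fun _ _ => m, fun _ _ => H / m⟩, hK1,
    fun _ _ => ⟨hHm, hmρ, hm, le_rfl⟩, ?_, ?_, ?_, ?_, ?_⟩
  · rw [← hX]; exact hMd
  · intro _
    rw [← hZ]
    refine hT2.trans ?_
    gcongr
    linarith
  · have h3 : ε ≤ A₃ * (εs K / q) := by
      have h4 : B / a ^ 2 * (r ^ K * Δ) ≤ B / q * (εs K / c₁) := by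
        rw [haq]
        gcongr
        rw [le_div_iff₀ hc₁]; linarith
      have h5 : A₃ * (εs K / q) = 3 / 2 * (B / q * (εs K / c₁)) := by
        rw [hA₃]; field_simp
      linarith
    refine h3.trans ?_
    gcongr
    linarith
  · intro Λ hΛ
    have hK' : (K : ℝ) ≤ 1 + 3 * Real.sqrt σ * Real.log (B * (σ * Δ / ε)) := by
      have h3 : 3 / a = 3 * Real.sqrt σ := by rw [haσ]; field_simp
      have h4 : Δ / (a ^ 2 * ε) = σ * Δ / ε := by rw [haq, hq]; field_simp
      rwa [h3, h4] at hKle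
    obtain ⟨hΛ0, hKΛ⟩ := LPI.outer_count_le hσ1 hε hεΔ hB2 hK' hΛ
    rw [← hA₁] at hKΛ
    have hY : 0 ≤ Real.sqrt σ * Λ := by positivity
    rw [← hZ, ← hX]
    refine ⟨hKΛ.trans ?_, ?_, ?_⟩
    · gcongr
      linarith
    · refine (LPI.oracleCalls_le (A := A₁ + A₂ + A₃ + A₁ * A₂) hA₁0.le (by linarith) hY hlZ hKΛ hT2
        le_rfl).trans (le_of_eq ?_)
      ring
    · refine (LPI.oracleCalls_le (A := A₁ + A₂ + A₃ + A₁ * A₂) hA₁0.le (by linarith) hY hlZ hKΛ hT2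
        hMd).trans (le_of_eq ?_)
      ring
  · intro n f x θ₀ hn hf hx hgap
    have hxc : ∀ j, x j ∈ LPI.cube d := by
      intro j
      rw [LPI.cube, Set.mem_Icc]
      exact ⟨fun i => hρ.le.trans (hx j i).1, fun i => (hx j i).2.trans (by
        simp only [Pi.one_apply]; linarith)⟩
    have hmH : m * (H / m) = H := by field_simp
    have hE0 : 0 ≤ W * (H / m) ^ η := by positivity
    have hloc := fun j => hint m (H / m) ρ (x j) hm hHm hmρ hmH (hx j)
    have hErr : p * (W * (H / m) ^ η) ^ 2 / (L₁ + (L₁ - μ)) ≤ c₁ * (r ^ K * Δ) / 2 :=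
      LPI.stationary_error_le hc₁ hc₂0 hL₁ (by linarith) hp0 hεK0 hXe hmE hεK2
    have hconv := LPI.catalyst_convergence (Ker := Ker) (l := LPI.order η) (εs := εs) (K := K)
      (S := ⟨fun _ => T, fun _ _ => m, fun _ _ => H / m⟩) (hf.quadBounds hn hxc)
      (hf.continuous_risk hxc) hL₁ ha ha1 hμa hc₂0.le (by linarith : 14 * c₂ ≤ B) hB2 hΔ.le
      (by rw [← hr]; exact fun k hk => (hεs k hk).2) θ₀ hgap (by
        intro k hk z θ hθ
        rw [← hr, haq] at hθ
        have hgd := LPI.gap_lpiGD_le (κ := L₁ - μ) hf hn hxc hE0 (fun j => (hloc j).1)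
          (fun j => (hloc j).2) (by linarith) (by linarith) (by linarith) z θ T
        refine hgd.trans ?_
        have hkK : r ^ K ≤ r ^ (k + 1) := pow_le_pow_of_le_one hr0.le hr1 hk
        have h3 := LPI.initial_error_le hc₁ hD hr23 hΔ.le hT1 hθ
        have h4 : c₁ * (r ^ K * Δ) / 2 ≤ c₁ * (r ^ (k + 1) * Δ) / 2 := by gcongr
        have h5 := (hεs (k + 1) (by omega)).1
        linarith)
    rw [← hr] at hconv
    exact ⟨hconv.1, hconv.2.trans hKup⟩
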